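/- **Theorem.** Let $k$ be a field (for example $k=\mathbb C$), let $n\ge 4$, let $A_n\in M_n(k)$ be the matrix with ones on the first superdiagonal and zeros elsewhere, and let $\mathrm{Sol}_{A_n^2}=\{X\in M_n(k)\mid X^tA_n^2X=A_n^2\}$. Then every element of $\mathrm{Sol}_{A_n^2}$ is invertible, so $\mathrm{Sol}_{A_n^2}$ is a group, and it is the (internal) semidirect product $N\rtimes D$, with $N$ a normal subgroup and $D$ a subgroup, where $D$ and $N$ are the sets of matrices described below. In particular, with $D$ acting on $N$ by conjugation, $(u,d)\mapsto ud$ is a group isomorphism $N\rtimes D\to \mathrm{Sol}_{A_n^2}$. *Conventions.* Put $m=\lceil n/2\rceil$. Matrices are written as $m\times m$ arrays of $2\times 2$ blocks $X_{p,q}$ ($1\le p,q\le m$); $1$ denotes the $2\times2$ identity block, and $g^{-t}=(g^{-1})^t$. If $n$ is odd, the blocks form a matrix of size $n+1$ whose first row and first column are zero, and the actual $n\times n$ matrix is obtained by deleting that row and column. In the definitions of $x_l^*$ all sums run over indices $r,s\ge1$, and all the sequences $x_1,x_2,\dots$ consist of matrices in $M_2(k)$. Put $a=\begin{pmatrix}0&0\\0&1\end{pmatrix}$.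 *The set $D$.* If $n$ is even, $D$ consists of the matrices $\mathrm{diag}(g,g^{-t},g,g^{-t},\dots)$ ($m$ blocks) with $g\in GL_2(k)$. If $n$ is odd, $D$ consists of the matrices $\mathrm{diag}(g_0,g_1,g_1^{-t},g_1,g_1^{-t},\dots)$ ($m$ blocks) with $g_0=\begin{pmatrix}0&0\\0&\beta\end{pmatrix}$, $g_1=\begin{pmatrix}\alpha&c\\0&\beta^{-1}\end{pmatrix}$, $\alpha,\beta\in k^\times$, $c\in k$. *The set $N$.* In each case all blocks not mentioned are zero. - $n\equiv0\pmod 4$: $x_l\in M_2(k)$ are arbitrary, and $x_l^*=\sum_{r+s=l}x_s^t(x_r^t-x_r^*)$. The blocks are $X_{q,q}=1$; for odd $q$, $X_{q-2l,q}=x_l$ ($l\ge1$); for even $q$, $X_{q+2l,q}=-x_l^t+x_l^*$ ($l\ge 1$). - $n\equiv2\pmod 4$: $x_l\in M_2(k)$ are arbitrary. The blocks are $X_{q,q}=1$; for even $q$ and $l\ge1$, $X_{q-2l+1,q}=x_l$ and $X_{q+2l-1,q}=-x_l^t$. - $n\equiv1\pmod 4$: $x_l=\begin{pmatrix}0&0\\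 *&*\end{pmatrix}$ for odd $l$, $x_l=\begin{pmatrix}*&*\\0&0\end{pmatrix}$ for even $l$, and $x_l^*=\sum_{r+s=l,\ s\text{ even}}x_s^t(x_r^t-x_r^*)$. The blocks are $X_{1,1}=a$; $X_{q,q}=1$ for $q\ge2$; for even $q$, $X_{q-l,q}=x_l$ for all $l\ge1$ and $X_{q+l,q}=-x_l^t+x_l^*$ for odd $l$; for odd $q\ge3$, $X_{q+l,q}=-x_l^t+x_l^*$ for even $l\ge 2$. - $n\equiv3\pmod 4$: for some $\lambda\in k$, $b=\begin{pmatrix}0&\lambda\\0&0\end{pmatrix}$, $x_1=\begin{pmatrix}*&*\\-\lambda&0\end{pmatrix}$, $x_l=\begin{pmatrix}*&*\\0&0\end{pmatrix}$ for odd $l\ge3$, $x_l=\begin{pmatrix}0&0\\ *&*\end{pmatrix}$ for even $l$; $x_l^*=\sum_{r+s=l,\ s\text{ even}}x_s^t(x_r^t-x_r^*)$ for even $l$, and $x_l^*=x_{l+1}^tb^t+\sum_{r+s=l,\ s\text{ even}}x_s^t(x_r^t-x_r^*)$ for odd $l$. The blocks are $X_{1,1}=a$, $X_{2,1}=b$;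 $X_{q,q}=1$ for $q\ge2$; for odd $q\ge3$, $X_{q-l,q}=x_l$ for all $l\ge1$ and $X_{q+l,q}=-x_l^t+x_l^*$ for odd $l$; for even $q$, $X_{q+l,q}=-x_l^t+x_l^*$ for even $l\ge2$. -/

import Mathlib

namespace CongruenceSol

open Matrix

/-- `Sol_A = {X | Xᵀ A X = A}`, a monoid under matrix multiplication. -/
def solMonoid {ι k : Type*} [Fintype ι] [DecidableEq ι] [Field k] (A : Matrix ι ι k) :
    Submonoid (Matrix ι ι k) where
  carrier := {X | Xᵀ * A * X = A}
  one_mem' := by simp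
  mul_mem' := by
    intro X Y hX hY
    change Xᵀ * A * X = A at hX
    change Yᵀ * A * Y = A at hY
    change (X * Y)ᵀ * A * (X * Y) = A
    calc (X * Y)ᵀ * A * (X * Y) = Yᵀ * (Xᵀ * A * X) * Y := by
          simp only [Matrix.transpose_mul, Matrix.mul_assoc]
      _ = A := by rw [hX, hY]

/-- The group `GL ∩ Sol_A` of invertible elements of `Sol_A`. -/
def solGroup {ι k : Type*} [Fintype ι] [DecidableEq ι] [Field k] (A : Matrix ι ι k) :
    Subgroup (GL ι k) where
  carrier := {X | (X : Matrix ι ι k) ∈ solMonoid A}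
  one_mem' := by simp [(solMonoid A).one_mem]
  mul_mem' := by
    intro X Y hX hY
    exact (solMonoid A).mul_mem hX hY
  inv_mem' := by
    intro X hX
    have h : (X : Matrix ι ι k)ᵀ * A * (X : Matrix ι ι k) = A := hX
    have h1 : (X : Matrix ι ι k) * ((X⁻¹ : GL ι k) : Matrix ι ι k) = 1 := by
      rw [← Units.val_mul, mul_inv_cancel, Units.val_one]
    have h2 : ((X⁻¹ : GL ι k) : Matrix ι ι k)ᵀ * (X : Matrix ι ι k)ᵀ = 1 := by
      rw [← Matrix.transpose_mul, h1, Matrix.transpose_one]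
    change ((X⁻¹ : GL ι k) : Matrix ι ι k)ᵀ * A * ((X⁻¹ : GL ι k) : Matrix ι ι k) = A
    calc ((X⁻¹ : GL ι k) : Matrix ι ι k)ᵀ * A * ((X⁻¹ : GL ι k) : Matrix ι ι k)
        = ((X⁻¹ : GL ι k) : Matrix ι ι k)ᵀ * ((X : Matrix ι ι k)ᵀ * A * (X : Matrix ι ι k))
            * ((X⁻¹ : GL ι k) : Matrix ι ι k) := by rw [h]
      _ = (((X⁻¹ : GL ι k) : Matrix ι ι k)ᵀ * (X : Matrix ι ι k)ᵀ) * A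
            * ((X : Matrix ι ι k) * ((X⁻¹ : GL ι k) : Matrix ι ι k)) := by
          simp only [Matrix.mul_assoc]
      _ = A := by rw [h1, h2, Matrix.one_mul, Matrix.mul_one]

/-- `A_n`: ones on the first superdiagonal, zeros elsewhere. -/
def jordan (k : Type*) [Field k] (n : ℕ) : Matrix (Fin n) (Fin n) k :=
  Matrix.of fun i j => if (j : ℕ) = (i : ℕ) + 1 then 1 else 0

/-- The `n × n` matrix with `2 × 2` blocks `B p q`, where `p, q = 1, 2, …, ⌈n/2⌉` are the block row
and the block column. For odd `n` the blocks form a matrix of size `n + 1`, whose first row and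
first column (the padding) are removed. -/
def ofBlocks {k : Type*} (n : ℕ) (B : ℕ → ℕ → Matrix (Fin 2) (Fin 2) k) :
    Matrix (Fin n) (Fin n) k :=
  Matrix.of fun i j =>
    B (((i : ℕ) + n % 2) / 2 + 1) (((j : ℕ) + n % 2) / 2 + 1)
      ⟨((i : ℕ) + n % 2) % 2, Nat.mod_lt _ two_pos⟩ ⟨((j : ℕ) + n % 2) % 2, Nat.mod_lt _ two_pos⟩

section D

variable {k : Type*} [Field k]

/-- Blocks of `diag(g, g⁻ᵗ, g, g⁻ᵗ, …)`. -/
def blocksDEven (g : GL (Fin 2) k) (p q : ℕ) : Matrix (Fin 2) (Fin 2) k :=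
  if p = q then
    if Odd p then (g : Matrix (Fin 2) (Fin 2) k) else ((g⁻¹ : GL (Fin 2) k) : Matrix (Fin 2) (Fin 2) k)ᵀ
  else 0

/-- Blocks of `diag(g₀, g₁, g₁⁻ᵗ, g₁, g₁⁻ᵗ, …)`, with `g₀ = (0 0; 0 β)`, `g₁ = (α c; 0 β⁻¹)`. -/
noncomputable def blocksDOdd (α β : kˣ) (c : k) (p q : ℕ) : Matrix (Fin 2) (Fin 2) k :=
  if p = q then
    if p = 1 then !![0, 0; 0, (β : k)]
    else if Even p then !![(α : k), c; 0, (β : k)⁻¹]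
    else ((!![(α : k), c; 0, (β : k)⁻¹] : Matrix (Fin 2) (Fin 2) k)⁻¹)ᵀ
  else 0

/-- The set `D` of block-diagonal matrices. -/
def setD (k : Type*) [Field k] (n : ℕ) : Set (Matrix (Fin n) (Fin n) k) :=
  if Even n then {X | ∃ g : GL (Fin 2) k, X = ofBlocks n (blocksDEven g)}
  else {X | ∃ (α β : kˣ) (c : k), X = ofBlocks n (blocksDOdd α β c)}

end D

section N

variable {k : Type*} [Field k]

/-! In each case the coordinates are `x 1, x 2, …` (only the finitely many that occur in the
matrix matter). -/

/-- `x*_l = ∑_{r+s=l} x_sᵗ (x_rᵗ - x*_r)`, the sum over `r, s ≥ 1`. -/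
def starZero (x : ℕ → Matrix (Fin 2) (Fin 2) k) : ℕ → Matrix (Fin 2) (Fin 2) k
  | l => ∑ r : Fin l, if 1 ≤ (r : ℕ) then (x (l - r))ᵀ * ((x r)ᵀ - starZero x r) else 0
decreasing_by exact r.2

/-- Blocks for `n ≡ 0 mod 4`. -/
def blocksNZero (x : ℕ → Matrix (Fin 2) (Fin 2) k) (p q : ℕ) : Matrix (Fin 2) (Fin 2) k :=
  if p = q then 1
  else if Odd q ∧ p < q ∧ Even (q - p) then x ((q - p) / 2)
  else if Even q ∧ q < p ∧ Even (p - q) then -(x ((p - q) / 2))ᵀ + starZero x ((p - q) / 2)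
  else 0

/-- Blocks for `n ≡ 2 mod 4`. -/
def blocksNTwo (x : ℕ → Matrix (Fin 2) (Fin 2) k) (p q : ℕ) : Matrix (Fin 2) (Fin 2) k :=
  if p = q then 1
  else if Even q ∧ p < q ∧ Odd (q - p) then x ((q - p + 1) / 2)
  else if Even q ∧ q < p ∧ Odd (p - q) then -(x ((p - q + 1) / 2))ᵀ
  else 0

/-- `x*_l = ∑_{r+s=l, s even} x_sᵗ (x_rᵗ - x*_r)`, the sum over `r, s ≥ 1`. -/
def starOne (x : ℕ → Matrix (Fin 2) (Fin 2) k) : ℕ → Matrix (Fin 2) (Fin 2) k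
  | l => ∑ r : Fin l,
      if 1 ≤ (r : ℕ) ∧ Even (l - r) then (x (l - r))ᵀ * ((x r)ᵀ - starOne x r) else 0
decreasing_by exact r.2

/-- Blocks for `n ≡ 1 mod 4`. -/
def blocksNOne (x : ℕ → Matrix (Fin 2) (Fin 2) k) (p q : ℕ) : Matrix (Fin 2) (Fin 2) k :=
  if q = 1 then if p = 1 then !![0, 0; 0, 1] else 0
  else if p = q then 1
  else if Even q ∧ p < q then x (q - p)
  else if (Even q ∧ q < p ∧ Odd (p - q)) ∨ (Odd q ∧ q < p ∧ Even (p - q)) then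
    -(x (p - q))ᵀ + starOne x (p - q)
  else 0

/-- Odd coordinates have the form `(0 0; ∗ ∗)`, even coordinates the form `(∗ ∗; 0 0)`. -/
def ShapeOne (x : ℕ → Matrix (Fin 2) (Fin 2) k) : Prop :=
  (∀ l, Odd l → ∃ s t : k, x l = !![0, 0; s, t]) ∧ (∀ l, Even l → ∃ s t : k, x l = !![s, t; 0, 0])

/-- With `b = (0 lam; 0 0)`: `x*_l = ∑_{r+s=l, s even} x_sᵗ (x_rᵗ - x*_r)` for even `l`, and
`x*_l = x_{l+1}ᵗ bᵗ + ∑_{r+s=l, s even} x_sᵗ (x_rᵗ - x*_r)` for odd `l`; here `r, s ≥ 1`. -/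
def starThree (lam : k) (x : ℕ → Matrix (Fin 2) (Fin 2) k) : ℕ → Matrix (Fin 2) (Fin 2) k
  | l => (if Odd l then (x (l + 1))ᵀ * (!![0, lam; 0, 0] : Matrix (Fin 2) (Fin 2) k)ᵀ else 0) +
      ∑ r : Fin l,
        if 1 ≤ (r : ℕ) ∧ Even (l - r) then (x (l - r))ᵀ * ((x r)ᵀ - starThree lam x r) else 0
decreasing_by exact r.2

/-- Blocks for `n ≡ 3 mod 4`. -/
def blocksNThree (lam : k) (x : ℕ → Matrix (Fin 2) (Fin 2) k) (p q : ℕ) :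
    Matrix (Fin 2) (Fin 2) k :=
  if q = 1 then if p = 1 then !![0, 0; 0, 1] else if p = 2 then !![0, lam; 0, 0] else 0
  else if p = q then 1
  else if Odd q ∧ p < q then x (q - p)
  else if (Odd q ∧ q < p ∧ Odd (p - q)) ∨ (Even q ∧ q < p ∧ Even (p - q)) then
    -(x (p - q))ᵀ + starThree lam x (p - q)
  else 0

/-- `x 1` has the form `(∗ ∗; -lam 0)`, odd coordinates from `x 3` on have the form `(∗ ∗; 0 0)`,
even coordinates the form `(0 0; ∗ ∗)`. -/
def ShapeThree (lam : k) (x : ℕ → Matrix (Fin 2) (Fin 2) k) : Prop :=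
  (∃ s t : k, x 1 = !![s, t; -lam, 0]) ∧
  (∀ l, 3 ≤ l → Odd l → ∃ s t : k, x l = !![s, t; 0, 0]) ∧
  (∀ l, Even l → ∃ s t : k, x l = !![0, 0; s, t])

/-- The set `N`, in the four cases of `n` modulo `4`. -/
def setN (k : Type*) [Field k] (n : ℕ) : Set (Matrix (Fin n) (Fin n) k) :=
  if n % 4 = 0 then
    {X | ∃ x : ℕ → Matrix (Fin 2) (Fin 2) k, X = ofBlocks n (blocksNZero x)}
  else if n % 4 = 2 then
    {X | ∃ x : ℕ → Matrix (Fin 2) (Fin 2) k, X = ofBlocks n (blocksNTwo x)}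
  else if n % 4 = 1 then
    {X | ∃ x : ℕ → Matrix (Fin 2) (Fin 2) k, ShapeOne x ∧ X = ofBlocks n (blocksNOne x)}
  else
    {X | ∃ (lam : k) (x : ℕ → Matrix (Fin 2) (Fin 2) k),
      ShapeThree lam x ∧ X = ofBlocks n (blocksNThree lam x)}

end N

end CongruenceSol

namespace CongruenceSol

open Matrix

variable {k : Type*} [Field k]

/-! ### Block coordinates of a matrix -/

/-- The entries of `X`, extended by zero and shifted so that the blocks start at even positions
`2, 4, …, 2 * ((n + 1) / 2)`. -/
def pent (n : ℕ) (X : Matrix (Fin n) (Fin n) k) (u v : ℕ) : k :=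
  if h : (n % 2 + 2 ≤ u ∧ u < n + (n % 2 + 2)) ∧ (n % 2 + 2 ≤ v ∧ v < n + (n % 2 + 2)) then
    X ⟨u - (n % 2 + 2), by omega⟩ ⟨v - (n % 2 + 2), by omega⟩ else 0

/-- The `2 × 2` blocks of `X`, numbered from `1`. -/
def blk (n : ℕ) (X : Matrix (Fin n) (Fin n) k) (p q : ℕ) : Matrix (Fin 2) (Fin 2) k :=
  Matrix.of fun a b => pent n X (2 * p + a) (2 * q + b)

/-- The first diagonal block of the identity matrix. -/
def padOne (k : Type*) [Field k] (n : ℕ) : Matrix (Fin 2) (Fin 2) k :=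
  if n % 2 = 0 then 1 else !![0, 0; 0, 1]

lemma pent_add (n : ℕ) (X : Matrix (Fin n) (Fin n) k) (i j : Fin n) :
    pent n X (i + (n % 2 + 2)) (j + (n % 2 + 2)) = X i j := by
  unfold pent
  rw [dif_pos (by omega)]
  congr 1 <;> ext <;> simp

lemma pent_of_not (n : ℕ) (X : Matrix (Fin n) (Fin n) k) {u v : ℕ}
    (h : ¬ ((n % 2 + 2 ≤ u ∧ u < n + (n % 2 + 2)) ∧ (n % 2 + 2 ≤ v ∧ v < n + (n % 2 + 2)))) :
    pent n X u v = 0 := dif_neg h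

lemma exists_of_pent_range {n u : ℕ} (h : n % 2 + 2 ≤ u) (h' : u < n + (n % 2 + 2)) :
    ∃ i : Fin n, u = i + (n % 2 + 2) := ⟨⟨u - (n % 2 + 2), by omega⟩, by simp; omega⟩

lemma ofBlocks_blk (n : ℕ) (X : Matrix (Fin n) (Fin n) k) : ofBlocks n (blk n X) = X := by
  ext i j
  simp only [ofBlocks, blk, Matrix.of_apply]
  rw [← pent_add n X i j]
  congr 1 <;> omega

lemma ofBlocks_congr {R : Type*} {n : ℕ} {B C : ℕ → ℕ → Matrix (Fin 2) (Fin 2) R}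
    (h : ∀ p q, 1 ≤ p → p ≤ (n + 1) / 2 → 1 ≤ q → q ≤ (n + 1) / 2 → B p q = C p q) :
    ofBlocks n B = ofBlocks n C := by
  ext i j
  simp only [ofBlocks, Matrix.of_apply]
  rw [h _ _ (by omega) (by omega) (by omega) (by omega)]

lemma eq_of_blk_eq {n : ℕ} {X Y : Matrix (Fin n) (Fin n) k}
    (h : ∀ p q, 1 ≤ p → p ≤ (n + 1) / 2 → 1 ≤ q → q ≤ (n + 1) / 2 → blk n X p q = blk n Y p q) :
    X = Y := by
  rw [← ofBlocks_blk n X, ← ofBlocks_blk n Y, ofBlocks_congr h]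

/-- The blocks `B` vanish in the positions that are removed for odd `n`. -/
def Padded (n : ℕ) (B : ℕ → ℕ → Matrix (Fin 2) (Fin 2) k) : Prop :=
  n % 2 = 1 → ∀ p, 1 ≤ p → ∀ c, B 1 p 0 c = 0 ∧ B p 1 c 0 = 0

lemma blk_padded (n : ℕ) (X : Matrix (Fin n) (Fin n) k) : Padded n (blk n X) := by
  intro h p _ c
  simp only [blk, Matrix.of_apply]
  constructor <;> exact pent_of_not n X (by simp [h])

lemma blk_ofBlocks {n : ℕ} {B : ℕ → ℕ → Matrix (Fin 2) (Fin 2) k} (hB : Padded n B) {p q : ℕ}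
    (hp : 1 ≤ p) (hp' : p ≤ (n + 1) / 2) (hq : 1 ≤ q) (hq' : q ≤ (n + 1) / 2) :
    blk n (ofBlocks n B) p q = B p q := by
  ext a b
  simp only [blk, Matrix.of_apply, pent, ofBlocks]
  have ha := a.2
  have hb := b.2
  split_ifs with h
  · have h1 : (2 * p + (a : ℕ) - (n % 2 + 2) + n % 2) / 2 + 1 = p := by omega
    have h2 : (2 * q + (b : ℕ) - (n % 2 + 2) + n % 2) / 2 + 1 = q := by omega
    have h3 : (⟨(2 * p + (a : ℕ) - (n % 2 + 2) + n % 2) % 2, Nat.mod_lt _ two_pos⟩ : Fin 2) = a := by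
      ext; simp only; omega
    have h4 : (⟨(2 * q + (b : ℕ) - (n % 2 + 2) + n % 2) % 2, Nat.mod_lt _ two_pos⟩ : Fin 2) = b := by
      ext; simp only; omega
    rw [h1, h2, h3, h4]
  · by_cases h5 : n % 2 + 2 ≤ 2 * p + (a : ℕ)
    · have hb0 : b = 0 := by ext; simp only [Fin.val_zero]; omega
      have : q = 1 := by omega
      subst hb0 this
      exact ((hB (by omega) p hp a).2).symm
    · have ha0 : a = 0 := by ext; simp only [Fin.val_zero]; omega
      have : p = 1 := by omega
      subst ha0 this
      exact ((hB (by omega) q hq b).1).symm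

lemma blk_transpose (n : ℕ) (X : Matrix (Fin n) (Fin n) k) (p q : ℕ) :
    blk n Xᵀ p q = (blk n X q p)ᵀ := by
  ext a b
  simp only [blk, Matrix.of_apply, Matrix.transpose_apply, pent, and_comm]

lemma sum_Ico_pairs (f : ℕ → k) (m : ℕ) :
    ∑ u ∈ Finset.Ico 2 (2 * m + 2), f u = ∑ r ∈ Finset.Icc 1 m, (f (2 * r) + f (2 * r + 1)) := by
  induction m with
  | zero => simp
  | succ m ih =>
    rw [Finset.sum_Icc_succ_top (by omega), ← ih, show 2 * (m + 1) + 2 = 2 * m + 2 + 1 + 1 by ring,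
      Finset.sum_Ico_succ_top (by omega), Finset.sum_Ico_succ_top (by omega)]
    ring_nf

lemma pent_mul (n : ℕ) (X Y : Matrix (Fin n) (Fin n) k) (u v : ℕ) :
    pent n (X * Y) u v =
      ∑ w ∈ Finset.Ico 2 (2 * ((n + 1) / 2) + 2), pent n X u w * pent n Y w v := by
  by_cases h : (n % 2 + 2 ≤ u ∧ u < n + (n % 2 + 2)) ∧ (n % 2 + 2 ≤ v ∧ v < n + (n % 2 + 2))
  · obtain ⟨i, rfl⟩ := exists_of_pent_range h.1.1 h.1.2
    obtain ⟨j, rfl⟩ := exists_of_pent_range h.2.1 h.2.2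
    rw [pent_add, Matrix.mul_apply]
    have h1 : ∀ l : Fin n, X i l * Y l j =
        (fun l : ℕ => pent n X (i + (n % 2 + 2)) (l + (n % 2 + 2)) *
          pent n Y (l + (n % 2 + 2)) (j + (n % 2 + 2))) l := by
      intro l
      simp only [pent_add]
    rw [Finset.sum_congr rfl fun l _ => h1 l, Fin.sum_univ_eq_sum_range
      (fun l : ℕ => pent n X (i + (n % 2 + 2)) (l + (n % 2 + 2)) *
          pent n Y (l + (n % 2 + 2)) (j + (n % 2 + 2))) n,
      Finset.range_eq_Ico, Finset.sum_Ico_add' (fun l : ℕ => pent n X (i + (n % 2 + 2)) l *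
          pent n Y l (j + (n % 2 + 2))) 0 n (n % 2 + 2)]
    refine Finset.sum_subset ?_ ?_
    · intro w; simp only [Finset.mem_Ico]; omega
    · intro w _ hw
      rw [pent_of_not, zero_mul]
      simp only [Finset.mem_Ico] at hw
      omega
  · rw [pent_of_not n _ h, Finset.sum_eq_zero]
    intro w _
    by_cases h1 : n % 2 + 2 ≤ u ∧ u < n + (n % 2 + 2)
    · rw [pent_of_not n Y (by tauto), mul_zero]
    · rw [pent_of_not n X (by tauto), zero_mul]

lemma blk_mul (n : ℕ) (X Y : Matrix (Fin n) (Fin n) k) (p q : ℕ) :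
    blk n (X * Y) p q = ∑ r ∈ Finset.Icc 1 ((n + 1) / 2), blk n X p r * blk n Y r q := by
  ext a b
  rw [Matrix.sum_apply]
  simp only [blk, Matrix.of_apply, pent_mul, sum_Ico_pairs, Matrix.mul_apply, Fin.sum_univ_two,
    Fin.val_zero, Fin.val_one, add_zero]

lemma blk_one {n p q : ℕ} (hp : 1 ≤ p) (hp' : p ≤ (n + 1) / 2) :
    blk n (1 : Matrix (Fin n) (Fin n) k) p q =
      if p = q then (if p = 1 then padOne k n else 1) else 0 := by
  ext a b
  have ha := a.2
  have hb := b.2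
  by_cases h : (n % 2 + 2 ≤ 2 * p + (a : ℕ) ∧ 2 * p + (a : ℕ) < n + (n % 2 + 2)) ∧
    (n % 2 + 2 ≤ 2 * q + (b : ℕ) ∧ 2 * q + (b : ℕ) < n + (n % 2 + 2))
  · simp only [blk, Matrix.of_apply, pent, dif_pos h, Matrix.one_apply, Fin.mk.injEq, padOne]
    by_cases hpq : p = q
    · subst hpq
      fin_cases a <;> fin_cases b <;> simp at h ⊢ <;> split_ifs <;> simp <;> omega
    · rw [if_neg (by omega), if_neg hpq, Matrix.zero_apply]
  · simp only [blk, Matrix.of_apply, pent, dif_neg h, padOne]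
    fin_cases a <;> fin_cases b <;> simp at h ⊢ <;> split_ifs <;> simp <;> omega

lemma jordan_sq_apply (n : ℕ) (i j : Fin n) :
    (jordan k n ^ 2) i j = if (j : ℕ) = (i : ℕ) + 2 then 1 else 0 := by
  rw [pow_two, Matrix.mul_apply]
  simp only [jordan, Matrix.of_apply, mul_ite, mul_one, mul_zero]
  split_ifs with h
  · rw [Finset.sum_eq_single ⟨i + 1, by omega⟩]
    · simp [h]
    · intro l _ hl
      have h2 : (l : ℕ) ≠ i + 1 := fun h2 => hl (Fin.ext h2)
      simp [h2]
    · simp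
  · refine Finset.sum_eq_zero fun l _ => ?_
    split_ifs <;> first | rfl | omega

lemma blk_jordan_sq {n p q : ℕ} (hp : 1 ≤ p) (hq' : q ≤ (n + 1) / 2) :
    blk n (jordan k n ^ 2) p q =
      if q = p + 1 then (if p = 1 then padOne k n else 1) else 0 := by
  ext a b
  have ha := a.2
  have hb := b.2
  by_cases h : (n % 2 + 2 ≤ 2 * p + (a : ℕ) ∧ 2 * p + (a : ℕ) < n + (n % 2 + 2)) ∧
    (n % 2 + 2 ≤ 2 * q + (b : ℕ) ∧ 2 * q + (b : ℕ) < n + (n % 2 + 2))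
  · simp only [blk, Matrix.of_apply, pent, dif_pos h, jordan_sq_apply, padOne]
    by_cases hpq : q = p + 1
    · subst hpq
      fin_cases a <;> fin_cases b <;> simp at h ⊢ <;> split_ifs <;> simp <;> omega
    · rw [if_neg (by omega), if_neg hpq, Matrix.zero_apply]
  · simp only [blk, Matrix.of_apply, pent, dif_neg h, padOne]
    fin_cases a <;> fin_cases b <;> simp at h ⊢ <;> split_ifs <;> simp <;> omega

lemma mul_padOne_of_padded {n : ℕ} {M : Matrix (Fin 2) (Fin 2) k}
    (h : n % 2 = 1 → ∀ c, M c 0 = 0) : M * padOne k n = M := by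
  unfold padOne
  split_ifs with h0
  · simp
  · ext a b
    fin_cases b <;> simp [Matrix.mul_apply, Fin.sum_univ_two, h (by omega) a]

/-- `Sol` in terms of blocks. -/
lemma mem_solMonoid_iff_blk {n : ℕ} (X : Matrix (Fin n) (Fin n) k) :
    X ∈ solMonoid (jordan k n ^ 2) ↔ ∀ i j, 1 ≤ i → i ≤ (n + 1) / 2 → 1 ≤ j → j ≤ (n + 1) / 2 →
      ∑ p ∈ Finset.Ico 1 ((n + 1) / 2), (blk n X p i)ᵀ * blk n X (p + 1) j =
        if j = i + 1 then (if i = 1 then padOne k n else 1) else 0 := by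
  have key : ∀ i j, 1 ≤ i → i ≤ (n + 1) / 2 → 1 ≤ j → j ≤ (n + 1) / 2 →
      blk n (Xᵀ * jordan k n ^ 2 * X) i j =
        ∑ p ∈ Finset.Ico 1 ((n + 1) / 2), (blk n X p i)ᵀ * blk n X (p + 1) j := by
    intro i j hi hi' hj hj'
    have h1 : ∀ r ∈ Finset.Icc 1 ((n + 1) / 2), blk n (Xᵀ * jordan k n ^ 2) i r =
        if 2 ≤ r then (blk n X (r - 1) i)ᵀ else 0 := by
      intro r hr
      rw [Finset.mem_Icc] at hr
      have h2 : ∀ p ∈ Finset.Icc 1 ((n + 1) / 2), blk n Xᵀ i p * blk n (jordan k n ^ 2) p r =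
          if p + 1 = r then (blk n X p i)ᵀ else 0 := by
        intro p hp
        rw [Finset.mem_Icc] at hp
        rw [blk_jordan_sq hp.1 hr.2, blk_transpose]
        by_cases h3 : r = p + 1
        · rw [if_pos h3, if_pos h3.symm]
          split_ifs with h4
          · subst h4
            refine mul_padOne_of_padded fun hn c => ?_
            rw [Matrix.transpose_apply]
            exact (blk_padded n X hn i hi c).1
          · rw [mul_one]
        · rw [if_neg h3, if_neg (Ne.symm h3), mul_zero]
      rw [blk_mul, Finset.sum_congr rfl h2]
      split_ifs with h5
      · rw [Finset.sum_eq_single (r - 1), if_pos (by omega)]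
        · intro p _ hp
          rw [if_neg (by omega)]
        · intro h6
          simp only [Finset.mem_Icc] at h6
          omega
      · refine Finset.sum_eq_zero fun p hp => ?_
        rw [Finset.mem_Icc] at hp
        rw [if_neg (by omega)]
    rw [blk_mul, Finset.sum_congr rfl fun r hr => by rw [h1 r hr],
      ← Finset.add_sum_Ioc_eq_sum_Icc (by omega : 1 ≤ (n + 1) / 2), if_neg (by omega), zero_mul,
      zero_add, Finset.sum_Ico_add' (fun p => (blk n X (p - 1) i)ᵀ * blk n X p j) 1 _ 1 |>.symm.trans
        (Finset.sum_congr rfl fun p _ => by rw [Nat.add_sub_cancel]) |>.symm]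
    refine Finset.sum_congr (by ext; simp; omega) fun r hr => ?_
    simp only [Finset.mem_Ico] at hr
    rw [if_pos (by omega)]
  constructor
  · intro (h : Xᵀ * jordan k n ^ 2 * X = jordan k n ^ 2) i j hi hi' hj hj'
    rw [← key i j hi hi' hj hj', h, blk_jordan_sq hi hj']
  · intro h
    change Xᵀ * jordan k n ^ 2 * X = jordan k n ^ 2
    refine eq_of_blk_eq fun i j hi hi' hj hj' => ?_
    rw [key i j hi hi' hj hj', h i j hi hi' hj hj', blk_jordan_sq hi hj']

/-! ### Linear relations between the entries of a solution -/

lemma sum_ite_val_eq {n : ℕ} (f : Fin n → k) (c : ℕ) :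
    ∑ l : Fin n, (if (l : ℕ) = c then f l else 0) = if h : c < n then f ⟨c, h⟩ else 0 := by
  split_ifs with h
  · rw [Finset.sum_eq_single ⟨c, h⟩]
    · simp
    · intro l _ hl
      rw [if_neg fun h1 => hl (Fin.ext h1)]
    · simp
  · refine Finset.sum_eq_zero fun l _ => if_neg ?_
    omega

lemma jordan_sq_mulVec {n : ℕ} (x : Fin n → k) (i : Fin n) :
    (jordan k n ^ 2 *ᵥ x) i = if h : (i : ℕ) + 2 < n then x ⟨i + 2, h⟩ else 0 := by
  rw [← sum_ite_val_eq]
  simp only [Matrix.mulVec, dotProduct, jordan_sq_apply, ite_mul, one_mul, zero_mul]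

lemma jordan_sq_transpose_mulVec {n : ℕ} (x : Fin n → k) (i : Fin n) (hi : 2 ≤ (i : ℕ)) :
    ((jordan k n ^ 2)ᵀ *ᵥ x) i = x ⟨i - 2, by omega⟩ := by
  have h : ∀ l : Fin n, ((jordan k n ^ 2)ᵀ i l) * x l =
      if (l : ℕ) = i - 2 then x l else 0 := by
    intro l
    rw [Matrix.transpose_apply, jordan_sq_apply, ite_mul, one_mul, zero_mul]
    refine if_congr ?_ rfl rfl
    omega
  simp only [Matrix.mulVec, dotProduct]
  rw [Finset.sum_congr rfl fun l _ => h l, sum_ite_val_eq, dif_pos]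

lemma isUnit_of_mem_solMonoid {n : ℕ} (hn : 4 ≤ n) {X : Matrix (Fin n) (Fin n) k}
    (hX : X ∈ solMonoid (jordan k n ^ 2)) : IsUnit X := by
  change Xᵀ * jordan k n ^ 2 * X = jordan k n ^ 2 at hX
  have hXt : Xᵀ * (jordan k n ^ 2)ᵀ * X = (jordan k n ^ 2)ᵀ := by
    conv_rhs => rw [← hX]
    simp only [Matrix.transpose_mul, Matrix.transpose_transpose, Matrix.mul_assoc]
  rw [← Matrix.mulVec_injective_iff_isUnit, ← Matrix.coe_mulVecLin, ← LinearMap.ker_eq_bot,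
    LinearMap.ker_eq_bot']
  intro x hx
  rw [Matrix.mulVecLin_apply] at hx
  have h1 : jordan k n ^ 2 *ᵥ x = 0 := by
    rw [← hX, ← Matrix.mulVec_mulVec, hx, Matrix.mulVec_zero]
  have h2 : (jordan k n ^ 2)ᵀ *ᵥ x = 0 := by
    rw [← hXt, ← Matrix.mulVec_mulVec, hx, Matrix.mulVec_zero]
  ext i
  by_cases hi : 2 ≤ (i : ℕ)
  · have := congrFun h1 ⟨i - 2, by omega⟩
    rw [jordan_sq_mulVec, dif_pos (by simp only; omega)] at this
    rw [Pi.zero_apply] at this ⊢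
    rw [← this]
    congr 1
    ext
    simp only
    omega
  · have := congrFun h2 ⟨i + 2, by omega⟩
    rw [jordan_sq_transpose_mulVec _ _ (by simp)] at this
    exact this

/-- The blockwise consequences of `J X = W J` and `Jᵀ X = W Jᵀ`, where `J` is the square of the
Jordan block and `W = X⁻ᵗ`. -/
lemma exists_pent_shift {n : ℕ} (hn : 4 ≤ n) {X : Matrix (Fin n) (Fin n) k}
    (hX : X ∈ solMonoid (jordan k n ^ 2)) : ∃ W : Matrix (Fin n) (Fin n) k,
    ∀ u v, n % 2 + 2 ≤ u → u < n + (n % 2 + 2) → n % 2 + 2 ≤ v → v < n + (n % 2 + 2) →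
      pent n X (u + 2) v = pent n W u (v - 2) ∧ pent n X (u - 2) v = pent n W u (v + 2) := by
  obtain ⟨U, rfl⟩ := isUnit_of_mem_solMonoid hn hX
  set X : Matrix (Fin n) (Fin n) k := ↑U with hXdef
  change Xᵀ * jordan k n ^ 2 * X = jordan k n ^ 2 at hX
  have hXt : Xᵀ * (jordan k n ^ 2)ᵀ * X = (jordan k n ^ 2)ᵀ := by
    conv_rhs => rw [← hX]
    simp only [Matrix.transpose_mul, Matrix.transpose_transpose, Matrix.mul_assoc]
  set V : Matrix (Fin n) (Fin n) k := ↑U⁻¹ with hV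
  have hVX : Vᵀ * Xᵀ = 1 := by
    rw [← Matrix.transpose_mul, hXdef, hV, Units.mul_inv, Matrix.transpose_one]
  have h1 : jordan k n ^ 2 * X = Vᵀ * jordan k n ^ 2 := by
    conv_rhs => rw [← hX]
    rw [← Matrix.mul_assoc, ← Matrix.mul_assoc, hVX, Matrix.one_mul]
  have h2 : (jordan k n ^ 2)ᵀ * X = Vᵀ * (jordan k n ^ 2)ᵀ := by
    conv_rhs => rw [← hXt]
    rw [← Matrix.mul_assoc, ← Matrix.mul_assoc, hVX, Matrix.one_mul]
  refine ⟨Vᵀ, fun u v hu hu' hv hv' => ?_⟩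
  obtain ⟨i, rfl⟩ := exists_of_pent_range hu hu'
  obtain ⟨j, rfl⟩ := exists_of_pent_range hv hv'
  have e1 := congrFun (congrFun h1 i) j
  have e2 := congrFun (congrFun h2 i) j
  rw [Matrix.mul_apply, Matrix.mul_apply] at e1 e2
  have a1 : ∀ l : Fin n, (jordan k n ^ 2) i l * X l j = if (l : ℕ) = i + 2 then X l j else 0 := by
    intro l; rw [jordan_sq_apply, ite_mul, one_mul, zero_mul]
  have a2 : ∀ l : Fin n, Vᵀ i l * (jordan k n ^ 2)ᵀ l j =
      if (l : ℕ) = j + 2 then Vᵀ i l else 0 := by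
    intro l; rw [Matrix.transpose_apply (jordan k n ^ 2), jordan_sq_apply, mul_ite, mul_one, mul_zero]
  have a3 : ∀ l : Fin n, (jordan k n ^ 2)ᵀ i l * X l j =
      if 2 ≤ (i : ℕ) then (if (l : ℕ) = i - 2 then X l j else 0) else 0 := by
    intro l
    rw [Matrix.transpose_apply, jordan_sq_apply, ite_mul, one_mul, zero_mul, ← ite_and]
    exact if_congr (by omega) rfl rfl
  have a4 : ∀ l : Fin n, Vᵀ i l * (jordan k n ^ 2) l j =
      if 2 ≤ (j : ℕ) then (if (l : ℕ) = j - 2 then Vᵀ i l else 0) else 0 := by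
    intro l
    rw [jordan_sq_apply, mul_ite, mul_one, mul_zero, ← ite_and]
    exact if_congr (by omega) rfl rfl
  simp only [a1, a2, a3, a4] at e1 e2
  constructor
  · trans ∑ l : Fin n, (if (l : ℕ) = i + 2 then X l j else 0)
    · rw [sum_ite_val_eq]
      split_ifs with h
      · refine Eq.trans ?_ (pent_add n X ⟨i + 2, h⟩ j); congr 1; simp only; omega
      · exact pent_of_not _ _ (by omega)
    · rw [e1]
      by_cases h : 2 ≤ (j : ℕ)
      · simp only [if_pos h]
        rw [sum_ite_val_eq, dif_pos (by omega)]
        refine (pent_add n Vᵀ i ⟨j - 2, by omega⟩).symm.trans ?_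
        congr 1; simp only; omega
      · simp only [if_neg h, Finset.sum_const_zero]
        exact (pent_of_not _ _ (by omega)).symm
  · trans ∑ l : Fin n, (if 2 ≤ (i : ℕ) then (if (l : ℕ) = i - 2 then X l j else 0) else 0)
    · by_cases h : 2 ≤ (i : ℕ)
      · simp only [if_pos h]
        rw [sum_ite_val_eq, dif_pos (by omega)]
        refine Eq.trans ?_ (pent_add n X ⟨i - 2, by omega⟩ j)
        congr 1; simp only; omega
      · simp only [if_neg h, Finset.sum_const_zero]
        exact (pent_of_not _ _ (by omega))
    · rw [e2, sum_ite_val_eq]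
      split_ifs with h
      · refine (pent_add n Vᵀ i ⟨j + 2, h⟩).symm.trans ?_; congr 1; simp only; omega
      · exact (pent_of_not _ _ (by omega)).symm

section Relations

variable {n : ℕ} {X : Matrix (Fin n) (Fin n) k}

lemma pent_add_four (hn : 4 ≤ n) (hX : X ∈ solMonoid (jordan k n ^ 2)) {u v : ℕ}
    (hu : n % 2 ≤ u) (hu' : u < n + n % 2) (hv : n % 2 + 2 ≤ v) (hv' : v + 2 < n + n % 2) :
    pent n X (u + 4) (v + 4) = pent n X u v := by
  obtain ⟨W, hW⟩ := exists_pent_shift hn hX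
  have h1 := (hW (u + 2) (v + 4) (by omega) (by omega) (by omega) (by omega)).1
  have h2 := (hW (u + 2) v (by omega) (by omega) (by omega) (by omega)).2
  rw [show u + 4 = u + 2 + 2 by ring, h1, show u = u + 2 - 2 by omega, h2]
  rfl

lemma pent_first_cols (hn : 4 ≤ n) (hX : X ∈ solMonoid (jordan k n ^ 2)) {u v : ℕ}
    (hu : n % 2 + 4 ≤ u) (hv : v < n % 2 + 4) : pent n X u v = 0 := by
  obtain ⟨W, hW⟩ := exists_pent_shift hn hX
  by_cases h : u < n + (n % 2 + 2) ∧ n % 2 + 2 ≤ v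
  · have h1 := (hW (u - 2) v (by omega) (by omega) (by omega) (by omega)).1
    rw [show u - 2 + 2 = u by omega] at h1
    rw [h1, pent_of_not _ _ (by omega)]
  · exact pent_of_not _ _ (by omega)

/-- The block Toeplitz relation. -/
lemma blk_add_two (hn : 4 ≤ n) (hX : X ∈ solMonoid (jordan k n ^ 2)) {p q : ℕ}
    (hp : 1 ≤ p) (hp' : p < (n + 1) / 2) (hq : 1 + n % 2 ≤ q) (hq' : q + 2 ≤ (n + 1) / 2) :
    blk n X (p + 2) (q + 2) = blk n X p q := by
  ext a b
  have ha := a.2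
  have hb := b.2
  simp only [blk, Matrix.of_apply]
  rw [← pent_add_four hn hX (u := 2 * p + a) (v := 2 * q + b) (by omega) (by omega) (by omega)
    (by omega)]
  congr 1 <;> ring

lemma blk_eq_zero_of_gt (n : ℕ) (X : Matrix (Fin n) (Fin n) k) {p q : ℕ} (h : (n + 1) / 2 < p) :
    blk n X p q = 0 := by
  ext a b
  exact pent_of_not _ _ (by omega)

lemma blk_lower_eq_zero (hn : 4 ≤ n) (hX : X ∈ solMonoid (jordan k n ^ 2)) {p q : ℕ}
    (hq : 1 ≤ q) (hp : p ≤ (n + 1) / 2) (hqp : q < p) (h : Odd (p + (n + 1) / 2)) :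
    blk n X p q = 0 := by
  suffices H : ∀ t p q, 1 ≤ q → q < p → p + 2 * t = (n + 1) / 2 + 1 → blk n X p q = 0 by
    obtain ⟨c, hc⟩ := h
    exact H (((n + 1) / 2 + 1 - p) / 2) p q hq hqp (by omega)
  clear h hq hp hqp p q
  intro t
  induction t with
  | zero => intro p q _ _ h; exact blk_eq_zero_of_gt n X (by omega)
  | succ t ih =>
    intro p q hq hqp h
    have h1 := ih (p + 2) (q + 2) (by omega) (by omega) (by omega)
    ext a b
    have ha := a.2
    have hb := b.2
    have h2 : pent n X (2 * (p + 2) + a) (2 * (q + 2) + b) = 0 := congrFun (congrFun h1 a) b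
    simp only [blk, Matrix.of_apply, Matrix.zero_apply]
    by_cases hb' : n % 2 + 2 ≤ 2 * q + (b : ℕ)
    · rw [← pent_add_four hn hX (by omega) (by omega) hb' (by omega), ← h2]
      congr 1 <;> ring
    · exact pent_of_not _ _ (by omega)

lemma blk_upper_eq_zero (hn : 4 ≤ n) (hX : X ∈ solMonoid (jordan k n ^ 2)) {p q : ℕ}
    (hp : 1 ≤ p) (hq : q ≤ (n + 1) / 2) (hpq : p < q) (h : Even (q + (n + 1) / 2)) :
    blk n X p q = 0 := by
  suffices H : ∀ t p q, 1 ≤ p → p < q → q + 2 * t = (n + 1) / 2 → blk n X p q = 0 by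
    obtain ⟨c, hc⟩ := h
    exact H (((n + 1) / 2 - q) / 2) p q hp hpq (by omega)
  clear h hp hq hpq p q
  intro t
  induction t with
  | zero =>
    intro p q hp hpq h
    obtain ⟨W, hW⟩ := exists_pent_shift hn hX
    ext a b
    have ha := a.2
    have hb := b.2
    simp only [blk, Matrix.of_apply, Matrix.zero_apply]
    have h1 := (hW (2 * p + a + 2) (2 * q + b) (by omega) (by omega) (by omega) (by omega)).2
    rw [Nat.add_sub_cancel] at h1
    rw [h1, pent_of_not _ _ (by omega)]
  | succ t ih =>
    intro p q hp hpq h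
    have h1 := ih (p + 2) (q + 2) (by omega) (by omega) (by omega)
    rw [← h1, blk_add_two hn hX (by omega) (by omega) (by omega) (by omega)]

lemma blk_mul_diag (hn : 4 ≤ n) {Y : Matrix (Fin n) (Fin n) k}
    (hX : X ∈ solMonoid (jordan k n ^ 2)) (hY : Y ∈ solMonoid (jordan k n ^ 2)) {c : ℕ}
    (hc : 1 ≤ c) (hc' : c ≤ (n + 1) / 2) :
    blk n (X * Y) c c = blk n X c c * blk n Y c c := by
  rw [blk_mul]
  refine Finset.sum_eq_single c (fun q hq hqc => ?_) (fun h => ?_)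
  · rw [Finset.mem_Icc] at hq
    rcases Nat.even_or_odd (q + (n + 1) / 2) with h1 | h1 <;>
    rcases Nat.even_or_odd (c + (n + 1) / 2) with h2 | h2 <;>
    rcases lt_or_gt_of_ne hqc with h3 | h3
    · rw [blk_upper_eq_zero hn hY hq.1 hc' h3 h2, mul_zero]
    · rw [blk_upper_eq_zero hn hX hc hq.2 h3 h1, zero_mul]
    · rw [blk_lower_eq_zero hn hX hq.1 hc' h3 h2, zero_mul]
    · rw [blk_upper_eq_zero hn hX hc hq.2 h3 h1, zero_mul]
    · rw [blk_upper_eq_zero hn hY hq.1 hc' h3 h2, mul_zero]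
    · rw [blk_lower_eq_zero hn hY hc hq.2 h3 h1, mul_zero]
    · rw [blk_lower_eq_zero hn hX hq.1 hc' h3 h2, zero_mul]
    · rw [blk_lower_eq_zero hn hY hc hq.2 h3 h1, mul_zero]
  · exact absurd (Finset.mem_Icc.2 ⟨hc, hc'⟩) h

/-- Neighbouring diagonal blocks determine each other. -/
lemma blk_diag_transpose_mul (hn : 4 ≤ n) (hX : X ∈ solMonoid (jordan k n ^ 2)) {q : ℕ}
    (hq : 1 ≤ q) (hq' : q + 1 ≤ (n + 1) / 2) :
    (blk n X q q)ᵀ * blk n X (q + 1) (q + 1) = if q = 1 then padOne k n else 1 := by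
  have h := (mem_solMonoid_iff_blk X).1 hX q (q + 1) hq (by omega) (by omega) hq'
  rw [if_pos rfl] at h
  rw [← h]
  symm
  refine Finset.sum_eq_single q (fun p hp hpq => ?_) (fun h => ?_)
  · rw [Finset.mem_Ico] at hp
    rcases Nat.even_or_odd (q + (n + 1) / 2) with h1 | h1 <;>
    rcases Nat.even_or_odd (p + (n + 1) / 2) with h2 | h2 <;>
    rcases lt_or_gt_of_ne hpq with h3 | h3
    · rw [blk_upper_eq_zero hn hX hp.1 (by omega) h3 h1, Matrix.transpose_zero, zero_mul]
    · rw [blk_lower_eq_zero hn hX (p := p + 1) (by omega) (by omega) (by omega)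
        (by rw [Nat.odd_iff]; rw [Nat.even_iff] at h2; omega), mul_zero]
    · rw [blk_upper_eq_zero hn hX hp.1 (by omega) h3 h1, Matrix.transpose_zero, zero_mul]
    · rw [blk_lower_eq_zero hn hX hq (by omega) h3 h2, Matrix.transpose_zero, zero_mul]
    · rw [blk_upper_eq_zero hn hX (p := p + 1) (by omega) (by omega) (by omega)
        (by rw [Nat.even_iff]; rw [Nat.odd_iff] at h1; omega), mul_zero]
    · rw [blk_lower_eq_zero hn hX (p := p + 1) (by omega) (by omega) (by omega)
        (by rw [Nat.odd_iff]; rw [Nat.even_iff] at h2; omega), mul_zero]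
    · rw [blk_upper_eq_zero hn hX (p := p + 1) (by omega) (by omega) (by omega)
        (by rw [Nat.even_iff]; rw [Nat.odd_iff] at h1; omega), mul_zero]
    · rw [blk_lower_eq_zero hn hX hq (by omega) h3 h2, Matrix.transpose_zero, zero_mul]
  · exact absurd (Finset.mem_Ico.2 ⟨hq, by omega⟩) h

lemma padOne_transpose (k : Type*) [Field k] (n : ℕ) : (padOne k n)ᵀ = padOne k n := by
  unfold padOne
  split_ifs
  · simp
  · ext i j; fin_cases i <;> fin_cases j <;> rfl

lemma blk_diag_eq (hn : 4 ≤ n) (hX : X ∈ solMonoid (jordan k n ^ 2))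
    (h1 : blk n X (1 + n % 2) (1 + n % 2) = 1) {q : ℕ} (hq : 1 ≤ q) (hq' : q ≤ (n + 1) / 2) :
    blk n X q q = if q = 1 then padOne k n else 1 := by
  have H : ∀ q, 1 + n % 2 ≤ q → q ≤ (n + 1) / 2 → blk n X q q = 1 := by
    intro q hq
    induction q, hq using Nat.le_induction with
    | base => intro _; exact h1
    | succ q hq ih =>
      intro h
      have h2 := blk_diag_transpose_mul hn hX (q := q) (by omega) h
      rw [ih (by omega), Matrix.transpose_one, one_mul] at h2
      rw [h2]
      split_ifs with h3
      · rw [padOne, if_pos (by omega)]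
      · rfl
  by_cases hq1 : q = 1
  · subst hq1
    rw [if_pos rfl]
    have h2 := blk_diag_transpose_mul hn hX (q := 1) le_rfl (by omega)
    rw [H 2 (by omega) (by omega), mul_one, if_pos rfl] at h2
    rw [← Matrix.transpose_transpose (blk n X 1 1), h2, padOne_transpose]
  · rw [if_neg hq1, H q (by omega) hq']

end Relations

/-! ### A common form of the four block patterns -/

/-- Block matrices whose part above the diagonal lives in the columns `q` with `q + m` odd, and
whose part below the diagonal lives in the rows `p` with `p + m` even. -/
def blocksUni (m : ℕ) (a b : Matrix (Fin 2) (Fin 2) k) (x z : ℕ → Matrix (Fin 2) (Fin 2) k)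
    (p q : ℕ) : Matrix (Fin 2) (Fin 2) k :=
  if q = 1 then if p = 1 then a else if p = 2 then b else 0
  else if p = q then 1
  else if p < q then if (q + m) % 2 = 1 then x (q - p) else 0
  else if (p + m) % 2 = 0 then z (p - q) else 0

/-- The left hand side of the recursion that determines `z` from `x`. -/
def recur (b : Matrix (Fin 2) (Fin 2) k) (x z : ℕ → Matrix (Fin 2) (Fin 2) k) (l : ℕ) :
    Matrix (Fin 2) (Fin 2) k :=
  z l + (x l)ᵀ + ∑ r ∈ Finset.Ico 1 l, (if (l - r) % 2 = 0 then (x (l - r))ᵀ * z r else 0) -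
    if l % 2 = 1 then (x (l + 1))ᵀ * bᵀ else 0

/-- The conditions on the coordinates that are used in the quadratic relations. -/
structure Admissible (m : ℕ) (a b : Matrix (Fin 2) (Fin 2) k)
    (x : ℕ → Matrix (Fin 2) (Fin 2) k) : Prop where
  even_odd : ∀ s r, 1 ≤ s → s % 2 = 0 → r % 2 = 1 →
    (x s)ᵀ * x r = if r = 1 then -((x s)ᵀ * bᵀ) else 0
  first : ∀ l, 1 ≤ l → (l + m) % 2 = 1 → a * x l = if l = 1 then -bᵀ else 0
  second : ∀ l, 1 ≤ l → (l + m) % 2 = 0 → bᵀ * x l = 0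
  b_eq_zero : m % 2 = 1 → b = 0
  a_mul_b : a * b = 0
  a_symm : aᵀ = a

section Eval

variable {m : ℕ} {a b : Matrix (Fin 2) (Fin 2) k} {x z : ℕ → Matrix (Fin 2) (Fin 2) k} {p q : ℕ}

lemma blocksUni_diag (hq : 2 ≤ q) : blocksUni m a b x z q q = 1 := by
  simp [blocksUni, show q ≠ 1 by omega]

lemma blocksUni_upper (hpq : p < q) (hp : 1 ≤ p) (h : (q + m) % 2 = 1) :
    blocksUni m a b x z p q = x (q - p) := by
  rw [blocksUni, if_neg (by omega), if_neg (by omega), if_pos hpq, if_pos h]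

lemma blocksUni_upper_zero (hpq : p < q) (hp : 1 ≤ p) (h : (q + m) % 2 = 0) :
    blocksUni m a b x z p q = 0 := by
  rw [blocksUni, if_neg (by omega), if_neg (by omega), if_pos hpq, if_neg (by omega)]

lemma blocksUni_lower (hpq : q < p) (hq : 2 ≤ q) (h : (p + m) % 2 = 0) :
    blocksUni m a b x z p q = z (p - q) := by
  rw [blocksUni, if_neg (by omega), if_neg (by omega), if_neg (by omega), if_pos h]

lemma blocksUni_lower_zero (hpq : q < p) (hq : 2 ≤ q) (h : (p + m) % 2 = 1) :
    blocksUni m a b x z p q = 0 := by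
  rw [blocksUni, if_neg (by omega), if_neg (by omega), if_neg (by omega), if_neg (by omega)]

end Eval

lemma Admissible.odd_even {m : ℕ} {a b : Matrix (Fin 2) (Fin 2) k}
    {x : ℕ → Matrix (Fin 2) (Fin 2) k} (h : Admissible m a b x) {s r : ℕ} (hs : 1 ≤ s)
    (hs' : s % 2 = 0) (hr : r % 2 = 1) :
    (x r)ᵀ * x s = if r = 1 then -(b * x s) else 0 := by
  have := congrArg Matrix.transpose (h.even_odd s r hs hs' hr)
  rw [Matrix.transpose_mul, Matrix.transpose_transpose] at this
  rw [this]
  split_ifs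
  · rw [Matrix.transpose_neg, Matrix.transpose_mul, Matrix.transpose_transpose,
      Matrix.transpose_transpose]
  · rw [Matrix.transpose_zero]

lemma sum_Ico_split {M : Type*} [AddCommMonoid M] (f : ℕ → M) {c d m : ℕ} (hc : 1 ≤ c)
    (hcd : c < d) (hd : d < m) :
    ∑ p ∈ Finset.Ico 1 m, f p = ∑ p ∈ Finset.Ico 1 c, f p + f c +
      ∑ p ∈ Finset.Ico (c + 1) d, f p + f d + ∑ p ∈ Finset.Ico (d + 1) m, f p := by
  rw [← Finset.sum_Ico_succ_top hc, Finset.sum_Ico_consecutive _ (by omega) (by omega),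
    ← Finset.sum_Ico_succ_top (by omega), Finset.sum_Ico_consecutive _ (by omega) (by omega)]

section Quadratic

variable {m : ℕ} {a b : Matrix (Fin 2) (Fin 2) k} {x z : ℕ → Matrix (Fin 2) (Fin 2) k} {i j : ℕ}

lemma quad_low (h : Admissible m a b x) (hj : 2 ≤ j) (hji : j ≤ i) (hi : i < m)
    (hact : (i + m) % 2 = 1) :
    ∑ p ∈ Finset.Ico 1 m, (blocksUni m a b x z p i)ᵀ * blocksUni m a b x z (p + 1) j =
      recur b x z (i + 1 - j) := by
  have e1 : ∑ p ∈ Finset.Ico 1 (j - 1),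
      (blocksUni m a b x z p i)ᵀ * blocksUni m a b x z (p + 1) j =
      - if (i + 1 - j) % 2 = 1 then (x (i + 1 - j + 1))ᵀ * bᵀ else 0 := by
    split_ifs with hl
    · rcases Nat.lt_or_ge 2 j with h3 | h3
      · rw [Finset.sum_eq_single (j - 2)]
        · rw [blocksUni_upper (by omega) (by omega) hact, blocksUni_upper (by omega) (by omega)
            (by omega), h.even_odd _ _ (by omega) (by omega) (by omega), if_pos (by omega)]
          congr 4
          omega
        · intro p hp hne
          rw [Finset.mem_Ico] at hp
          rw [blocksUni_upper (by omega) (by omega) hact, blocksUni_upper (by omega) (by omega)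
            (by omega)]
          rcases Nat.mod_two_eq_zero_or_one (i - p) with h2 | h2
          · rw [h.even_odd _ _ (by omega) (by omega) (by omega), if_neg (by omega)]
          · rw [h.odd_even (by omega) (by omega) (by omega), if_neg (by omega)]
        · intro h4
          rw [Finset.mem_Ico] at h4
          omega
      · rw [h.b_eq_zero (by omega), Finset.Ico_eq_empty (by omega)]
        simp
    · rw [neg_zero]
      refine Finset.sum_eq_zero fun p hp => ?_
      rw [Finset.mem_Ico] at hp
      rw [blocksUni_upper_zero (p := p + 1) (by omega) (by omega) (by omega), mul_zero]
  have e2 : ∑ p ∈ Finset.Ico (j - 1 + 1) i,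
      (blocksUni m a b x z p i)ᵀ * blocksUni m a b x z (p + 1) j =
      ∑ r ∈ Finset.Ico 1 (i + 1 - j),
        (if (i + 1 - j - r) % 2 = 0 then (x (i + 1 - j - r))ᵀ * z r else 0) := by
    rw [show Finset.Ico (j - 1 + 1) i = Finset.Ico (1 + (j - 1)) ((i + 1 - j) + (j - 1)) by
      congr 1 <;> omega, ← Finset.sum_Ico_add']
    refine Finset.sum_congr rfl fun r hr => ?_
    rw [Finset.mem_Ico] at hr
    rw [blocksUni_upper (by omega) (by omega) hact]
    split_ifs with h2
    · rw [blocksUni_lower (by omega) hj (by omega)]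
      congr 3 <;> omega
    · rw [blocksUni_lower_zero (by omega) hj (by omega), mul_zero]
  have e3 : ∑ p ∈ Finset.Ico (i + 1) m,
      (blocksUni m a b x z p i)ᵀ * blocksUni m a b x z (p + 1) j = 0 := by
    refine Finset.sum_eq_zero fun p hp => ?_
    rw [Finset.mem_Ico] at hp
    rcases Nat.mod_two_eq_zero_or_one (p + m) with h2 | h2
    · rw [blocksUni_lower_zero (p := p + 1) (by omega) hj (by omega), mul_zero]
    · rw [blocksUni_lower_zero (q := i) (by omega) (by omega) h2, Matrix.transpose_zero, zero_mul]
  rw [sum_Ico_split _ (by omega : 1 ≤ j - 1) (by omega : j - 1 < i) hi, e1, e2, e3,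
    blocksUni_upper (q := i) (by omega) (by omega) hact, show j - 1 + 1 = j by omega,
    blocksUni_diag hj, blocksUni_diag (by omega), blocksUni_lower (by omega) hj (by omega),
    Matrix.transpose_one, one_mul, mul_one, recur, show i - (j - 1) = i + 1 - j by omega]
  abel

lemma quad_high (h : Admissible m a b x) (hi : 2 ≤ i) (hij : i + 1 < j) (hj : j ≤ m)
    (hact : (j + m) % 2 = 1) :
    ∑ p ∈ Finset.Ico 1 m, (blocksUni m a b x z p i)ᵀ * blocksUni m a b x z (p + 1) j =
      (recur b x z (j - i - 1))ᵀ := by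
  have e1 : ∑ p ∈ Finset.Ico 1 i,
      (blocksUni m a b x z p i)ᵀ * blocksUni m a b x z (p + 1) j =
      - if (j - i - 1) % 2 = 1 then b * x (j - i - 1 + 1) else 0 := by
    split_ifs with hl
    · rw [Finset.sum_eq_single (i - 1)]
      · rw [blocksUni_upper (by omega) (by omega) (by omega), blocksUni_upper (by omega) (by omega)
          (by omega), h.odd_even (by omega) (by omega) (by omega), if_pos (by omega)]
        congr 3
        omega
      · intro p hp hne
        rw [Finset.mem_Ico] at hp
        rw [blocksUni_upper (by omega) (by omega) (by omega), blocksUni_upper (by omega) (by omega)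
          (by omega)]
        rcases Nat.mod_two_eq_zero_or_one (i - p) with h2 | h2
        · rw [h.even_odd _ _ (by omega) (by omega) (by omega), if_neg (by omega)]
        · rw [h.odd_even (by omega) (by omega) (by omega), if_neg (by omega)]
      · intro h4
        rw [Finset.mem_Ico] at h4
        omega
    · rw [neg_zero]
      refine Finset.sum_eq_zero fun p hp => ?_
      rw [Finset.mem_Ico] at hp
      rw [blocksUni_upper_zero (q := i) (by omega) (by omega) (by omega), Matrix.transpose_zero,
        zero_mul]
  have e2 : ∑ p ∈ Finset.Ico (i + 1) (j - 1),
      (blocksUni m a b x z p i)ᵀ * blocksUni m a b x z (p + 1) j =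
      ∑ r ∈ Finset.Ico 1 (j - i - 1),
        (if (j - i - 1 - r) % 2 = 0 then (z r)ᵀ * x (j - i - 1 - r) else 0) := by
    rw [show Finset.Ico (i + 1) (j - 1) = Finset.Ico (1 + i) ((j - i - 1) + i) by
      congr 1 <;> omega, ← Finset.sum_Ico_add']
    refine Finset.sum_congr rfl fun r hr => ?_
    rw [Finset.mem_Ico] at hr
    rw [blocksUni_upper (q := j) (by omega) (by omega) hact]
    split_ifs with h2
    · rw [blocksUni_lower (by omega) hi (by omega), show r + i - i = r by omega,
        show j - (r + i + 1) = j - i - 1 - r by omega]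
    · rw [blocksUni_lower_zero (by omega) hi (by omega), Matrix.transpose_zero, zero_mul]
  have e3 : ∑ p ∈ Finset.Ico (j - 1 + 1) m,
      (blocksUni m a b x z p i)ᵀ * blocksUni m a b x z (p + 1) j = 0 := by
    refine Finset.sum_eq_zero fun p hp => ?_
    rw [Finset.mem_Ico] at hp
    rcases Nat.mod_two_eq_zero_or_one (p + m) with h2 | h2
    · rw [blocksUni_lower_zero (p := p + 1) (by omega) (by omega) (by omega), mul_zero]
    · rw [blocksUni_lower_zero (q := i) (by omega) (by omega) h2, Matrix.transpose_zero, zero_mul]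
  have e4 : (recur b x z (j - i - 1))ᵀ = (z (j - i - 1))ᵀ + x (j - i - 1) +
      ∑ r ∈ Finset.Ico 1 (j - i - 1),
        (if (j - i - 1 - r) % 2 = 0 then (z r)ᵀ * x (j - i - 1 - r) else 0) -
      if (j - i - 1) % 2 = 1 then b * x (j - i - 1 + 1) else 0 := by
    rw [recur, Matrix.transpose_sub, Matrix.transpose_add, Matrix.transpose_add,
      Matrix.transpose_sum]
    simp only [apply_ite Matrix.transpose, Matrix.transpose_mul, Matrix.transpose_transpose,
      Matrix.transpose_zero]
  rw [sum_Ico_split _ (by omega : 1 ≤ i) (by omega : i < j - 1) (by omega), e1, e2, e3, e4,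
    blocksUni_upper (q := j) (by omega) (by omega) hact, show j - 1 + 1 = j by omega,
    blocksUni_diag hi, blocksUni_diag (by omega), blocksUni_lower (by omega) hi (by omega),
    Matrix.transpose_one, one_mul, mul_one, show j - (i + 1) = j - i - 1 by omega,
    show j - 1 - i = j - i - 1 by omega]
  abel

lemma quad_succ (hi : 2 ≤ i) (hi' : i + 1 ≤ m) :
    ∑ p ∈ Finset.Ico 1 m, (blocksUni m a b x z p i)ᵀ * blocksUni m a b x z (p + 1) (i + 1) = 1 := by
  rw [Finset.sum_eq_single i]
  · rw [blocksUni_diag hi, blocksUni_diag (by omega), Matrix.transpose_one, one_mul]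
  · intro p hp hne
    rw [Finset.mem_Ico] at hp
    rcases Nat.mod_two_eq_zero_or_one (i + m) with h1 | h1 <;>
    rcases Nat.mod_two_eq_zero_or_one (p + m) with h2 | h2 <;>
    rcases lt_or_gt_of_ne hne with h3 | h3
    · rw [blocksUni_upper_zero h3 hp.1 h1, Matrix.transpose_zero, zero_mul]
    · rw [blocksUni_lower_zero (p := p + 1) (by omega) (by omega) (by omega), mul_zero]
    · rw [blocksUni_upper_zero h3 hp.1 h1, Matrix.transpose_zero, zero_mul]
    · rw [blocksUni_lower_zero h3 hi h2, Matrix.transpose_zero, zero_mul]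
    · rw [blocksUni_upper_zero (p := p + 1) (by omega) (by omega) (by omega), mul_zero]
    · rw [blocksUni_lower_zero (p := p + 1) (by omega) (by omega) (by omega), mul_zero]
    · rw [blocksUni_upper_zero (p := p + 1) (by omega) (by omega) (by omega), mul_zero]
    · rw [blocksUni_lower_zero h3 hi h2, Matrix.transpose_zero, zero_mul]
  · intro h
    rw [Finset.mem_Ico] at h
    omega

lemma quad_low_zero (hj : 2 ≤ j) (hji : j ≤ i) (hact : (i + m) % 2 = 0) :
    ∑ p ∈ Finset.Ico 1 m, (blocksUni m a b x z p i)ᵀ * blocksUni m a b x z (p + 1) j = 0 := by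
  refine Finset.sum_eq_zero fun p hp => ?_
  rw [Finset.mem_Ico] at hp
  rcases Nat.lt_or_ge p i with h3 | h3
  · rw [blocksUni_upper_zero h3 hp.1 hact, Matrix.transpose_zero, zero_mul]
  · rcases Nat.mod_two_eq_zero_or_one (p + m) with h2 | h2
    · rw [blocksUni_lower_zero (p := p + 1) (by omega) (by omega) (by omega), mul_zero]
    · rw [blocksUni_lower_zero (q := i) (by omega) (by omega) h2, Matrix.transpose_zero, zero_mul]

lemma quad_high_zero (hi : 2 ≤ i) (hij : i + 1 < j) (hact : (j + m) % 2 = 0) :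
    ∑ p ∈ Finset.Ico 1 m, (blocksUni m a b x z p i)ᵀ * blocksUni m a b x z (p + 1) j = 0 := by
  refine Finset.sum_eq_zero fun p hp => ?_
  rw [Finset.mem_Ico] at hp
  rcases Nat.lt_or_ge (p + 1) j with h3 | h3
  · rw [blocksUni_upper_zero (p := p + 1) h3 (by omega) hact, mul_zero]
  · rcases Nat.mod_two_eq_zero_or_one (p + m) with h2 | h2
    · rw [blocksUni_lower_zero (p := p + 1) (by omega) (by omega) (by omega), mul_zero]
    · rw [blocksUni_lower_zero (q := i) (by omega) (by omega) h2, Matrix.transpose_zero, zero_mul]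

lemma quad_first_row (h : Admissible m a b x) (hm : 2 ≤ m) (hj : 2 ≤ j) (hj' : j ≤ m) :
    ∑ p ∈ Finset.Ico 1 m, (blocksUni m a b x z p 1)ᵀ * blocksUni m a b x z (p + 1) j =
      if j = 2 then a else 0 := by
  have e0 : ∀ p, 1 ≤ p → (blocksUni m a b x z p 1) = if p = 1 then a else if p = 2 then b else 0 := by
    intro p _
    simp [blocksUni]
  have e1 : (blocksUni m a b x z 1 1)ᵀ * blocksUni m a b x z (1 + 1) j +
      bᵀ * blocksUni m a b x z 3 j = if j = 2 then a else 0 := by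
    rw [e0 1 le_rfl, if_pos rfl, h.a_symm]
    rcases Nat.lt_or_ge 2 j with h2 | h2
    · rw [if_neg (by omega)]
      rcases Nat.mod_two_eq_zero_or_one (j + m) with h3 | h3
      · rw [blocksUni_upper_zero h2 (by omega) h3, mul_zero, zero_add]
        rcases Nat.lt_or_ge 3 j with h4 | h4
        · rw [blocksUni_upper_zero h4 (by omega) h3, mul_zero]
        · rw [h.b_eq_zero (by omega), Matrix.transpose_zero, zero_mul]
      · rw [blocksUni_upper h2 (by omega) h3, h.first _ (by omega) (by omega)]
        rcases Nat.lt_or_ge 3 j with h4 | h4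
        · rw [blocksUni_upper h4 (by omega) h3, h.second _ (by omega) (by omega), if_neg (by omega),
            zero_add]
        · have : j = 3 := by omega
          subst this
          rw [if_pos rfl, blocksUni_diag (by omega), mul_one, neg_add_cancel]
    · have : j = 2 := by omega
      subst this
      rw [if_pos rfl, blocksUni_diag le_rfl, mul_one]
      rcases Nat.mod_two_eq_zero_or_one m with h3 | h3
      · rw [blocksUni_lower_zero (by omega) le_rfl (by omega), mul_zero, add_zero]
      · rw [h.b_eq_zero h3, Matrix.transpose_zero, zero_mul, add_zero]
  rw [← e1]
  have e2 : ∀ p ∈ Finset.Ico 3 m,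
      (blocksUni m a b x z p 1)ᵀ * blocksUni m a b x z (p + 1) j = 0 := by
    intro p hp
    rw [Finset.mem_Ico] at hp
    rw [e0 p (by omega), if_neg (by omega), if_neg (by omega), Matrix.transpose_zero, zero_mul]
  rcases Nat.lt_or_ge 2 m with h2 | h2
  · rw [Finset.sum_eq_sum_Ico_succ_bot (by omega), Finset.sum_eq_sum_Ico_succ_bot (by omega),
      Finset.sum_eq_zero e2, add_zero, e0 2 (by omega)]
    simp
  · have : m = 2 := by omega
    subst this
    have : j = 2 := by omega
    subst this
    rw [blocksUni_lower_zero (p := 3) (by omega) le_rfl (by omega), mul_zero, add_zero]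
    simp

lemma quad_first_col (h : Admissible m a b x) (hi : 1 ≤ i) :
    ∑ p ∈ Finset.Ico 1 m, (blocksUni m a b x z p i)ᵀ * blocksUni m a b x z (p + 1) 1 = 0 := by
  refine Finset.sum_eq_zero fun p hp => ?_
  rw [Finset.mem_Ico] at hp
  by_cases hp1 : p = 1
  · subst hp1
    have e0 : blocksUni m a b x z (1 + 1) 1 = b := by simp [blocksUni]
    rw [e0]
    by_cases hi1 : i = 1
    · subst hi1
      rw [show blocksUni m a b x z 1 1 = a by simp [blocksUni], h.a_symm, h.a_mul_b]
    · rcases Nat.mod_two_eq_zero_or_one (i + m) with h3 | h3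
      · rw [blocksUni_upper_zero (by omega) le_rfl h3, Matrix.transpose_zero, zero_mul]
      · rw [blocksUni_upper (by omega) le_rfl h3]
        have := congrArg Matrix.transpose (h.second (i - 1) (by omega) (by omega))
        rwa [Matrix.transpose_mul, Matrix.transpose_transpose, Matrix.transpose_zero] at this
  · have e0 : blocksUni m a b x z (p + 1) 1 = 0 := by
      simp [blocksUni, hp1, show p ≠ 0 by omega]
    rw [e0, mul_zero]

end Quadratic

/-- Admissible coordinates satisfying the recursion give solutions. -/
lemma ofBlocks_blocksUni_mem {n : ℕ} (hn : 4 ≤ n) {b : Matrix (Fin 2) (Fin 2) k}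
    {x z : ℕ → Matrix (Fin 2) (Fin 2) k} (h : Admissible ((n + 1) / 2) (padOne k n) b x)
    (hz : ∀ l, 1 ≤ l → recur b x z l = 0)
    (hpad : Padded n (blocksUni ((n + 1) / 2) (padOne k n) b x z)) :
    ofBlocks n (blocksUni ((n + 1) / 2) (padOne k n) b x z) ∈ solMonoid (jordan k n ^ 2) := by
  rw [mem_solMonoid_iff_blk]
  intro i j hi hi' hj hj'
  have e0 : ∀ p ∈ Finset.Ico 1 ((n + 1) / 2),
      (blk n (ofBlocks n (blocksUni ((n + 1) / 2) (padOne k n) b x z)) p i)ᵀ *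
        blk n (ofBlocks n (blocksUni ((n + 1) / 2) (padOne k n) b x z)) (p + 1) j =
      (blocksUni ((n + 1) / 2) (padOne k n) b x z p i)ᵀ *
        blocksUni ((n + 1) / 2) (padOne k n) b x z (p + 1) j := by
    intro p hp
    rw [Finset.mem_Ico] at hp
    rw [blk_ofBlocks hpad hp.1 (by omega) hi hi', blk_ofBlocks hpad (by omega) (by omega) hj hj']
  rw [Finset.sum_congr rfl e0]
  by_cases hj1 : j = 1
  · subst hj1
    rw [quad_first_col h hi, if_neg (by omega)]
  by_cases hi1 : i = 1
  · subst hi1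
    rw [quad_first_row h (by omega) (by omega) hj', if_pos rfl]
  rw [if_neg hi1]
  by_cases hij : j = i + 1
  · subst hij
    rw [quad_succ (by omega) hj', if_pos rfl]
  rw [if_neg hij]
  rcases Nat.lt_or_ge (i + 1) j with h1 | h1
  · rcases Nat.mod_two_eq_zero_or_one (j + (n + 1) / 2) with h2 | h2
    · exact quad_high_zero (by omega) h1 h2
    · rw [quad_high h (by omega) h1 hj' h2, hz _ (by omega), Matrix.transpose_zero]
  · rcases Nat.mod_two_eq_zero_or_one (i + (n + 1) / 2) with h2 | h2
    · exact quad_low_zero (by omega) (by omega) h2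
    · rw [quad_low h (by omega) (by omega) (by omega) h2, hz _ (by omega)]

lemma starThree_eq (lam : k) (x : ℕ → Matrix (Fin 2) (Fin 2) k) (l : ℕ) :
    starThree lam x l =
      (if l % 2 = 1 then (x (l + 1))ᵀ * (!![0, lam; 0, 0] : Matrix (Fin 2) (Fin 2) k)ᵀ else 0) -
      ∑ r ∈ Finset.Ico 1 l, (if (l - r) % 2 = 0 then
        (x (l - r))ᵀ * (-(x r)ᵀ + starThree lam x r) else 0) := by
  rw [starThree, Fin.sum_univ_eq_sum_range
    (fun r => if 1 ≤ r ∧ Even (l - r) then (x (l - r))ᵀ * ((x r)ᵀ - starThree lam x r) else 0) l,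
    sub_eq_add_neg, ← Finset.sum_neg_distrib]
  simp only [Nat.odd_iff, Nat.even_iff]
  congr 1
  symm
  refine Finset.sum_subset_zero_on_sdiff ?_ ?_ ?_
  · intro r; simp only [Finset.mem_Ico, Finset.mem_range]; omega
  · intro r hr
    simp only [Finset.mem_sdiff, Finset.mem_Ico, Finset.mem_range] at hr
    rw [if_neg (by omega)]
  · intro r hr
    rw [Finset.mem_Ico] at hr
    by_cases h : (l - r) % 2 = 0
    · rw [if_pos h, if_pos ⟨hr.1, h⟩, ← mul_neg]
      congr 1
      abel
    · rw [if_neg h, if_neg fun h1 => h h1.2, neg_zero]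

lemma recur_star (lam : k) (x : ℕ → Matrix (Fin 2) (Fin 2) k) (l : ℕ) :
    recur !![0, lam; 0, 0] x (fun l => -(x l)ᵀ + starThree lam x l) l = 0 := by
  rw [recur, starThree_eq lam x l]
  abel

lemma eq_star_of_recur {lam : k} {x z : ℕ → Matrix (Fin 2) (Fin 2) k} {L : ℕ}
    (h : ∀ l, 1 ≤ l → l ≤ L → recur !![0, lam; 0, 0] x z l = 0) :
    ∀ l, 1 ≤ l → l ≤ L → z l = -(x l)ᵀ + starThree lam x l := by
  intro l
  induction l using Nat.strong_induction_on with
  | _ l ih =>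
    intro h1 hL
    have e1 := h l h1 hL
    have e2 := recur_star lam x l
    rw [recur] at e1 e2
    have e3 : ∑ r ∈ Finset.Ico 1 l, (if (l - r) % 2 = 0 then (x (l - r))ᵀ * z r else 0) =
        ∑ r ∈ Finset.Ico 1 l, (if (l - r) % 2 = 0 then
          (x (l - r))ᵀ * (-(x r)ᵀ + starThree lam x r) else 0) := by
      refine Finset.sum_congr rfl fun r hr => ?_
      rw [Finset.mem_Ico] at hr
      rw [ih r hr.2 hr.1 (by omega)]
    rw [e3] at e1
    exact (add_left_inj _).1 ((add_left_inj _).1 (sub_left_inj.1 (e1.trans e2.symm)))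

/-! ### The kernel of the diagonal block, in coordinates -/

/-- The constraints on the coordinates of an element of `N`, uniformly in `n`. -/
structure Coordinates (n : ℕ) (lam : k) (x : ℕ → Matrix (Fin 2) (Fin 2) k) : Prop where
  lam_even : n % 2 = 0 → lam = 0
  lam_odd : (n + 1) / 2 % 2 = 1 → lam = 0
  first : ∀ l, 1 ≤ l → (l + (n + 1) / 2) % 2 = 1 →
    padOne k n * x l = if l = 1 then -(!![0, lam; 0, 0] : Matrix (Fin 2) (Fin 2) k)ᵀ else 0
  pad : n % 2 = 1 → ∀ l, 1 ≤ l → (l + (n + 1) / 2) % 2 = 0 → ∀ c, x l 0 c = 0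

lemma corner_zero : (!![0, 0; 0, 0] : Matrix (Fin 2) (Fin 2) k) = 0 := by
  ext i j; fin_cases i <;> fin_cases j <;> rfl

lemma padOne_even {n : ℕ} (h : n % 2 = 0) : padOne k n = 1 := if_pos h

lemma padOne_odd {n : ℕ} (h : n % 2 = 1) : padOne k n = !![0, 0; 0, 1] := if_neg (by omega)

lemma padOne_mul_of_padded {n : ℕ} {M : Matrix (Fin 2) (Fin 2) k}
    (h : n % 2 = 1 → ∀ c, M 0 c = 0) : padOne k n * M = M := by
  have := mul_padOne_of_padded (n := n) (M := Mᵀ) h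
  rw [← padOne_transpose, ← Matrix.transpose_mul] at this
  exact Matrix.transpose_injective this

lemma Coordinates.admissible {n : ℕ} {lam : k} {x : ℕ → Matrix (Fin 2) (Fin 2) k}
    (h : Coordinates n lam x) :
    Admissible ((n + 1) / 2) (padOne k n) !![0, lam; 0, 0] x where
  even_odd := by
    intro s r hs hs' hr
    rcases Nat.mod_two_eq_zero_or_one ((n + 1) / 2) with hm | hm
    · have e1 : padOne k n * x s = x s :=
        padOne_mul_of_padded fun hn c => h.pad hn s hs (by omega) c
      have e2 := h.first r (by omega) (by omega)
      rw [← e1, Matrix.transpose_mul, padOne_transpose, Matrix.mul_assoc, e2]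
      split_ifs with hr1
      · rw [← padOne_transpose, ← Matrix.transpose_mul, e1, mul_neg]
      · rw [mul_zero]
    · have e1 : padOne k n * x r = x r :=
        padOne_mul_of_padded fun hn c => h.pad hn r (by omega) (by omega) c
      have e2 := h.first s (by omega) (by omega)
      rw [if_neg (by omega)] at e2
      rw [← e1, ← Matrix.mul_assoc, ← padOne_transpose, ← Matrix.transpose_mul, e2, h.lam_odd hm,
        corner_zero]
      simp
  first := h.first
  second := by
    intro l hl hl'
    rcases Nat.mod_two_eq_zero_or_one n with hn | hn
    · rw [h.lam_even hn, corner_zero, Matrix.transpose_zero, zero_mul]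
    · have := h.pad hn l hl hl'
      ext i j
      fin_cases i <;> simp [Matrix.mul_apply, Fin.sum_univ_two, this]
  b_eq_zero := fun hm => by rw [h.lam_odd hm, corner_zero]
  a_mul_b := by
    rcases Nat.mod_two_eq_zero_or_one n with hn | hn
    · rw [h.lam_even hn, corner_zero, mul_zero]
    · rw [padOne_odd hn]
      ext i j
      fin_cases i <;> fin_cases j <;> simp [Matrix.mul_apply, Fin.sum_univ_two]
  a_symm := padOne_transpose k n

/-- The matrix with given coordinates. -/
def ofCoordinates (n : ℕ) (lam : k) (x : ℕ → Matrix (Fin 2) (Fin 2) k) :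
    Matrix (Fin n) (Fin n) k :=
  ofBlocks n (blocksUni ((n + 1) / 2) (padOne k n) !![0, lam; 0, 0] x
    fun l => -(x l)ᵀ + starThree lam x l)

lemma Coordinates.padded {n : ℕ} {lam : k} {x : ℕ → Matrix (Fin 2) (Fin 2) k}
    (h : Coordinates n lam x) (z : ℕ → Matrix (Fin 2) (Fin 2) k) :
    Padded n (blocksUni ((n + 1) / 2) (padOne k n) !![0, lam; 0, 0] x z) := by
  intro hn p hp c
  rw [padOne_odd hn]
  constructor
  · by_cases hp1 : p = 1
    · subst hp1
      fin_cases c <;> simp [blocksUni]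
    · rcases Nat.mod_two_eq_zero_or_one (p + (n + 1) / 2) with h1 | h1
      · rw [blocksUni_upper_zero (by omega) le_rfl h1, Matrix.zero_apply]
      · rw [blocksUni_upper (by omega) le_rfl h1, h.pad hn _ (by omega) (by omega)]
  · simp only [blocksUni, if_true]
    split_ifs <;> fin_cases c <;> simp

lemma Coordinates.mem {n : ℕ} (hn : 4 ≤ n) {lam : k} {x : ℕ → Matrix (Fin 2) (Fin 2) k}
    (h : Coordinates n lam x) : ofCoordinates n lam x ∈ solMonoid (jordan k n ^ 2) :=
  ofBlocks_blocksUni_mem hn h.admissible (fun l _ => recur_star lam x l) (h.padded _)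

lemma Coordinates.blk_eq_one {n : ℕ} (hn : 4 ≤ n) {lam : k} {x : ℕ → Matrix (Fin 2) (Fin 2) k}
    (h : Coordinates n lam x) : blk n (ofCoordinates n lam x) (1 + n % 2) (1 + n % 2) = 1 := by
  rw [ofCoordinates, blk_ofBlocks (h.padded _) (by omega) (by omega) (by omega) (by omega)]
  rcases Nat.mod_two_eq_zero_or_one n with h2 | h2
  · simp [h2, blocksUni, padOne_even h2]
  · rw [h2, blocksUni_diag le_rfl]

section Forward

variable {n : ℕ} {X : Matrix (Fin n) (Fin n) k}

lemma blk_second_first (hn : 4 ≤ n) (hX : X ∈ solMonoid (jordan k n ^ 2)) :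
    blk n X 2 1 = !![0, blk n X 2 1 0 1; 0, 0] := by
  ext a b
  fin_cases a <;> fin_cases b
  · change blk n X 2 1 0 0 = 0
    rcases Nat.mod_two_eq_zero_or_one n with h | h
    · exact pent_first_cols hn hX (by simp; omega) (by simp)
    · exact (blk_padded n X h 2 (by omega) 0).2
  · rfl
  · change blk n X 2 1 1 0 = 0
    exact pent_first_cols hn hX (by simp; omega) (by simp)
  · change blk n X 2 1 1 1 = 0
    exact pent_first_cols hn hX (by simp; omega) (by simp)

lemma blk_first_col (hn : 4 ≤ n) (hX : X ∈ solMonoid (jordan k n ^ 2)) {p : ℕ} (hp : 3 ≤ p) :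
    blk n X p 1 = 0 := by
  ext a b
  have := b.2
  exact pent_first_cols hn hX (by omega) (by omega)

lemma blk_quad_first_row (hn : 4 ≤ n) (hX : X ∈ solMonoid (jordan k n ^ 2)) {j : ℕ}
    (hj : 1 ≤ j) (hj' : j ≤ (n + 1) / 2) :
    (blk n X 1 1)ᵀ * blk n X 2 j + (blk n X 2 1)ᵀ * blk n X 3 j =
      if j = 2 then padOne k n else 0 := by
  have h := (mem_solMonoid_iff_blk X).1 hX 1 j le_rfl (by omega) hj hj'
  rw [if_pos rfl] at h
  rw [← h]
  have e2 : ∀ p ∈ Finset.Ico 3 ((n + 1) / 2),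
      (blk n X p 1)ᵀ * blk n X (p + 1) j = 0 := by
    intro p hp
    rw [Finset.mem_Ico] at hp
    rw [blk_first_col hn hX hp.1, Matrix.transpose_zero, zero_mul]
  rcases Nat.lt_or_ge 2 ((n + 1) / 2) with h2 | h2
  · rw [Finset.sum_eq_sum_Ico_succ_bot (by omega), Finset.sum_eq_sum_Ico_succ_bot (by omega),
      Finset.sum_eq_zero e2, add_zero]
  · have h3 : (n + 1) / 2 = 2 := by omega
    rw [blk_eq_zero_of_gt n X (p := 3) (by omega), mul_zero, add_zero, h3]
    simp

/-- The coordinates of a matrix. -/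
def coordX (n : ℕ) (X : Matrix (Fin n) (Fin n) k) (l : ℕ) : Matrix (Fin 2) (Fin 2) k :=
  if l = 0 then 0 else if (l + (n + 1) / 2) % 2 = 0 then blk n X 1 (1 + l) else blk n X 2 (2 + l)

/-- The blocks of a matrix below the diagonal. -/
def coordZ (n : ℕ) (X : Matrix (Fin n) (Fin n) k) (l : ℕ) : Matrix (Fin 2) (Fin 2) k :=
  if (l + (n + 1) / 2) % 2 = 0 then blk n X (l + 2) 2 else blk n X (l + 3) 3

lemma blk_eq_coordX (hn : 4 ≤ n) (hX : X ∈ solMonoid (jordan k n ^ 2)) {p q : ℕ} (hp : 1 ≤ p)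
    (hpq : p < q) (hq : q ≤ (n + 1) / 2) (hact : (q + (n + 1) / 2) % 2 = 1) :
    blk n X p q = coordX n X (q - p) := by
  induction p using Nat.strong_induction_on generalizing q with
  | _ p ih =>
    rcases Nat.lt_or_ge 2 p with h2 | h2
    · rw [show p = p - 2 + 2 by omega, show q = q - 2 + 2 by omega,
        blk_add_two hn hX (by omega) (by omega) (by omega) (by omega),
        ih (p - 2) (by omega) (by omega) (by omega) (by omega) (by omega)]
      congr 1
      omega
    · rw [coordX, if_neg (by omega)]
      rcases (by omega : p = 1 ∨ p = 2) with rfl | rfl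
      · rw [if_pos (by omega)]
        congr 1
        omega
      · rw [if_neg (by omega)]
        congr 1
        omega

lemma blk_eq_coordZ (hn : 4 ≤ n) (hX : X ∈ solMonoid (jordan k n ^ 2)) {p q : ℕ} (hq : 2 ≤ q)
    (hpq : q < p) (hp : p ≤ (n + 1) / 2) (hact : (p + (n + 1) / 2) % 2 = 0) :
    blk n X p q = coordZ n X (p - q) := by
  induction q using Nat.strong_induction_on generalizing p with
  | _ q ih =>
    rcases Nat.lt_or_ge 3 q with h2 | h2
    · rw [show p = p - 2 + 2 by omega, show q = q - 2 + 2 by omega,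
        blk_add_two hn hX (by omega) (by omega) (by omega) (by omega),
        ih (q - 2) (by omega) (by omega) (by omega) (by omega) (by omega)]
      congr 1
      omega
    · rw [coordZ]
      rcases (by omega : q = 2 ∨ q = 3) with rfl | rfl
      · rw [if_pos (by omega), Nat.sub_add_cancel (by omega)]
      · rw [if_neg (by omega), Nat.sub_add_cancel (by omega)]

lemma blk_eq_blocksUni (hn : 4 ≤ n) (hX : X ∈ solMonoid (jordan k n ^ 2))
    (h1 : blk n X (1 + n % 2) (1 + n % 2) = 1) {p q : ℕ} (hp : 1 ≤ p) (hp' : p ≤ (n + 1) / 2)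
    (hq : 1 ≤ q) (hq' : q ≤ (n + 1) / 2) :
    blk n X p q = blocksUni ((n + 1) / 2) (padOne k n) !![0, blk n X 2 1 0 1; 0, 0]
      (coordX n X) (coordZ n X) p q := by
  by_cases hq1 : q = 1
  · subst hq1
    rw [blocksUni, if_pos rfl]
    split_ifs with hp1 hp2
    · subst hp1
      rw [blk_diag_eq hn hX h1 le_rfl hp', if_pos rfl]
    · subst hp2
      exact blk_second_first hn hX
    · exact blk_first_col hn hX (by omega)
  rcases lt_trichotomy p q with h | h | h
  · rcases Nat.mod_two_eq_zero_or_one (q + (n + 1) / 2) with h2 | h2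
    · rw [blk_upper_eq_zero hn hX hp hq' h (Nat.even_iff.2 h2), blocksUni_upper_zero h hp h2]
    · rw [blk_eq_coordX hn hX hp h hq' h2, blocksUni_upper h hp h2]
  · subst h
    rw [blk_diag_eq hn hX h1 hp hp', if_neg hq1, blocksUni_diag (by omega)]
  · rcases Nat.mod_two_eq_zero_or_one (p + (n + 1) / 2) with h2 | h2
    · rw [blk_eq_coordZ hn hX (by omega) h hp' h2, blocksUni_lower h (by omega) h2]
    · rw [blk_lower_eq_zero hn hX hq hp' h (Nat.odd_iff.2 h2),
        blocksUni_lower_zero h (by omega) h2]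

lemma blk_eq_zero_of_gt_right (n : ℕ) (X : Matrix (Fin n) (Fin n) k) {p q : ℕ}
    (h : (n + 1) / 2 < q) : blk n X p q = 0 := by
  rw [← Matrix.transpose_transpose X, blk_transpose, blk_eq_zero_of_gt n _ h,
    Matrix.transpose_zero]

lemma coordinates_of_mem (hn : 4 ≤ n) (hX : X ∈ solMonoid (jordan k n ^ 2))
    (h1 : blk n X (1 + n % 2) (1 + n % 2) = 1) :
    Coordinates n (blk n X 2 1 0 1) (coordX n X) := by
  have hb := blk_second_first hn hX
  have h11 : (blk n X 1 1)ᵀ = padOne k n := by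
    rw [blk_diag_eq hn hX h1 le_rfl (by omega), if_pos rfl, padOne_transpose]
  have hlam0 : n % 2 = 0 → blk n X 2 1 0 1 = 0 := fun h =>
    pent_first_cols hn hX (by simp; omega) (by simp)
  have hpad : n % 2 = 1 → ∀ l, 1 ≤ l → (l + (n + 1) / 2) % 2 = 0 → ∀ c, coordX n X l 0 c = 0 := by
    intro h l hl hl' c
    rw [coordX, if_neg (by omega), if_pos hl']
    exact (blk_padded n X h _ (by omega) c).1
  refine ⟨hlam0, ?_, ?_, hpad⟩
  · intro hm
    have h3 := blk_quad_first_row hn hX (j := 3) (by omega) (by omega)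
    rw [blk_upper_eq_zero hn hX (p := 2) (q := 3) (by omega) (by omega) (by omega)
      (by rw [Nat.even_iff]; omega), mul_zero, zero_add, if_neg (by omega),
      blk_diag_eq hn hX h1 (by omega) (by omega), if_neg (by omega), mul_one] at h3
    exact congrFun (congrFun h3 1) 0
  · intro l hl hl'
    rw [← hb, coordX, if_neg (by omega), if_neg (by omega)]
    rcases Nat.lt_or_ge ((n + 1) / 2) (2 + l) with h2 | h2
    · rw [blk_eq_zero_of_gt_right n X h2, mul_zero]
      split_ifs with hl1
      · rw [hb, hlam0 (by omega), corner_zero]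
        simp
      · rfl
    · have h3 := blk_quad_first_row hn hX (j := 2 + l) (by omega) h2
      rw [h11, if_neg (by omega)] at h3
      rw [eq_neg_of_add_eq_zero_left h3]
      split_ifs with hl1
      · subst hl1
        rw [blk_diag_eq hn hX h1 (by omega) (by omega), if_neg (by omega), mul_one]
      · rw [neg_eq_zero, hb]
        rcases Nat.mod_two_eq_zero_or_one n with h4 | h4
        · rw [hlam0 h4, corner_zero, Matrix.transpose_zero, zero_mul]
        · rw [blk_eq_coordX hn hX (by omega) (by omega) h2 (by omega)]
          have := hpad h4 (2 + l - 3) (by omega) (by omega)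
          ext i j
          fin_cases i <;> simp [Matrix.mul_apply, Fin.sum_univ_two, this]

lemma eq_ofCoordinates (hn : 4 ≤ n) (hX : X ∈ solMonoid (jordan k n ^ 2))
    (h1 : blk n X (1 + n % 2) (1 + n % 2) = 1) :
    X = ofCoordinates n (blk n X 2 1 0 1) (coordX n X) := by
  have hc := coordinates_of_mem hn hX h1
  have hU := fun {p q : ℕ} => blk_eq_blocksUni hn hX h1 (p := p) (q := q)
  have hz : ∀ l, 1 ≤ l → l ≤ (n + 1) / 2 - 2 → coordZ n X l =
      -(coordX n X l)ᵀ + starThree (blk n X 2 1 0 1) (coordX n X) l := by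
    refine eq_star_of_recur fun l hl hl' => ?_
    have h2 := (mem_solMonoid_iff_blk X).1 hX ((n + 1) / 2 - 1) ((n + 1) / 2 - l) (by omega)
      (by omega) (by omega) (by omega)
    rw [if_neg (by omega)] at h2
    have e0 : ∀ p ∈ Finset.Ico 1 ((n + 1) / 2),
        (blk n X p ((n + 1) / 2 - 1))ᵀ * blk n X (p + 1) ((n + 1) / 2 - l) =
          (blocksUni ((n + 1) / 2) (padOne k n) !![0, blk n X 2 1 0 1; 0, 0] (coordX n X)
            (coordZ n X) p ((n + 1) / 2 - 1))ᵀ *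
          blocksUni ((n + 1) / 2) (padOne k n) !![0, blk n X 2 1 0 1; 0, 0] (coordX n X)
            (coordZ n X) (p + 1) ((n + 1) / 2 - l) := by
      intro p hp
      rw [Finset.mem_Ico] at hp
      rw [hU hp.1 (by omega) (by omega) (by omega),
        hU (p := p + 1) (by omega) (by omega) (by omega) (by omega)]
    rw [Finset.sum_congr rfl e0, quad_low hc.admissible (by omega) (by omega) (by omega)
      (by omega)] at h2
    rw [← h2]
    congr 1
    omega
  conv_lhs => rw [← ofBlocks_blk n X]
  refine ofBlocks_congr fun p q hp hp' hq hq' => ?_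
  rw [hU hp hp' hq hq']
  unfold blocksUni
  split_ifs <;> try rfl
  exact hz _ (by omega) (by omega)

end Forward

/-! ### The four cases -/

lemma exists_bottom_row {M : Matrix (Fin 2) (Fin 2) k} :
    (∃ s t : k, M = !![0, 0; s, t]) ↔ ∀ c, M 0 c = 0 := by
  constructor
  · rintro ⟨s, t, rfl⟩ c
    fin_cases c <;> rfl
  · intro h
    refine ⟨M 1 0, M 1 1, ?_⟩
    ext i j
    fin_cases i <;> fin_cases j <;> simp [h]

lemma exists_top_row {M : Matrix (Fin 2) (Fin 2) k} {r : k} :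
    (∃ s t : k, M = !![s, t; -r, 0]) ↔
      (!![0, 0; 0, 1] : Matrix (Fin 2) (Fin 2) k) * M = -(!![0, r; 0, 0])ᵀ := by
  constructor
  · rintro ⟨s, t, rfl⟩
    ext i j
    fin_cases i <;> fin_cases j <;> simp [Matrix.mul_apply, Fin.sum_univ_two]
  · intro h
    refine ⟨M 0 0, M 0 1, ?_⟩
    have h0 := congrFun (congrFun h 1) 0
    have h1 := congrFun (congrFun h 1) 1
    simp [Matrix.mul_apply, Fin.sum_univ_two] at h0 h1
    ext i j
    fin_cases i <;> fin_cases j <;> simp [h0, h1]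

lemma exists_top_row_zero {M : Matrix (Fin 2) (Fin 2) k} :
    (∃ s t : k, M = !![s, t; 0, 0]) ↔ (!![0, 0; 0, 1] : Matrix (Fin 2) (Fin 2) k) * M = 0 := by
  have := exists_top_row (M := M) (r := 0)
  rwa [neg_zero, corner_zero, Matrix.transpose_zero, neg_zero] at this

lemma starThree_zero (x : ℕ → Matrix (Fin 2) (Fin 2) k) (l : ℕ) :
    starThree 0 x l = starOne x l := by
  induction l using Nat.strong_induction_on with
  | _ l ih =>
    rw [starThree, starOne, corner_zero, Matrix.transpose_zero, mul_zero, ite_self, zero_add]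
    refine Finset.sum_congr rfl fun r _ => ?_
    rw [ih r r.2]

lemma ofCoordinates_one {n : ℕ} (h : n % 4 = 1) (x : ℕ → Matrix (Fin 2) (Fin 2) k) :
    ofCoordinates n 0 x = ofBlocks n (blocksNOne x) := by
  refine ofBlocks_congr fun p q hp hp' hq hq' => ?_
  rw [padOne_odd (by omega), corner_zero]
  simp only [blocksUni, blocksNOne, starThree_zero, Nat.even_iff, Nat.odd_iff, ite_self]
  split_ifs <;> first | rfl | omega

lemma ofCoordinates_three {n : ℕ} (h : n % 4 = 3) (lam : k) (x : ℕ → Matrix (Fin 2) (Fin 2) k) :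
    ofCoordinates n lam x = ofBlocks n (blocksNThree lam x) := by
  refine ofBlocks_congr fun p q hp hp' hq hq' => ?_
  rw [padOne_odd (by omega)]
  simp only [blocksUni, blocksNThree, Nat.even_iff, Nat.odd_iff]
  split_ifs <;> first | rfl | omega

lemma ofCoordinates_two {n : ℕ} (h : n % 4 = 2) {x y : ℕ → Matrix (Fin 2) (Fin 2) k}
    (hy : ∀ l, 1 ≤ l → l % 2 = 0 → y l = 0) (hxy : ∀ l, 1 ≤ l → l % 2 = 1 → y l = x ((l + 1) / 2)) :
    ofCoordinates n 0 y = ofBlocks n (blocksNTwo x) := by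
  have hs : ∀ l, starThree 0 y l = 0 := by
    intro l
    rw [starThree_eq, corner_zero, Matrix.transpose_zero, mul_zero, ite_self, zero_sub,
      neg_eq_zero]
    refine Finset.sum_eq_zero fun r hr => ?_
    rw [Finset.mem_Ico] at hr
    split_ifs with h1
    · rw [hy _ (by omega) h1, Matrix.transpose_zero, zero_mul]
    · rfl
  refine ofBlocks_congr fun p q hp hp' hq hq' => ?_
  rw [padOne_even (by omega), corner_zero]
  simp only [blocksUni, blocksNTwo, hs, add_zero, Nat.even_iff, Nat.odd_iff, ite_self]
  split_ifs
  all_goals first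
    | rfl
    | omega
    | rw [hxy _ (by omega) (by omega)]
    | (rw [hy _ (by omega) (by omega)]; done)
    | rw [hy _ (by omega) (by omega), Matrix.transpose_zero, neg_zero]

lemma sum_Ico_even {M : Type*} [AddCommMonoid M] (f : ℕ → M) {t : ℕ} (ht : 1 ≤ t) :
    ∑ r ∈ Finset.Ico 1 (2 * t), (if r % 2 = 0 then f (r / 2) else 0) =
      ∑ r ∈ Finset.Ico 1 t, f r := by
  induction t, ht using Nat.le_induction with
  | base => simp
  | succ t ht ih =>
    rw [show 2 * (t + 1) = 2 * t + 1 + 1 by ring, Finset.sum_Ico_succ_top (by omega),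
      Finset.sum_Ico_succ_top (by omega), ih, Finset.sum_Ico_succ_top ht, if_pos (by omega),
      if_neg (by omega), add_zero, Nat.mul_div_cancel_left t two_pos]

lemma starZero_eq (x : ℕ → Matrix (Fin 2) (Fin 2) k) (l : ℕ) :
    starZero x l = ∑ r ∈ Finset.Ico 1 l, (x (l - r))ᵀ * ((x r)ᵀ - starZero x r) := by
  rw [starZero, Fin.sum_univ_eq_sum_range
    (fun r => if 1 ≤ r then (x (l - r))ᵀ * ((x r)ᵀ - starZero x r) else 0) l]
  symm
  refine Finset.sum_subset_zero_on_sdiff ?_ ?_ ?_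
  · intro r; simp only [Finset.mem_Ico, Finset.mem_range]; omega
  · intro r hr
    simp only [Finset.mem_sdiff, Finset.mem_Ico, Finset.mem_range] at hr
    rw [if_neg (by omega)]
  · intro r hr
    rw [Finset.mem_Ico] at hr
    rw [if_pos hr.1]

lemma starThree_double {x y : ℕ → Matrix (Fin 2) (Fin 2) k}
    (hy : ∀ l, 1 ≤ l → l % 2 = 1 → y l = 0) (hxy : ∀ l, 1 ≤ l → l % 2 = 0 → y l = x (l / 2))
    {l : ℕ} (hl : 1 ≤ l) :
    starThree 0 y l = if l % 2 = 0 then starZero x (l / 2) else 0 := by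
  induction l using Nat.strong_induction_on with
  | _ l ih =>
    rw [starThree_eq, corner_zero, Matrix.transpose_zero, mul_zero, ite_self, zero_sub]
    split_ifs with h
    · rw [starZero_eq, ← sum_Ico_even (fun r => (x (l / 2 - r))ᵀ * ((x r)ᵀ - starZero x r))
        (t := l / 2) (by omega), ← Finset.sum_neg_distrib, show 2 * (l / 2) = l by omega]
      refine Finset.sum_congr rfl fun r hr => ?_
      rw [Finset.mem_Ico] at hr
      split_ifs with h1 h2 h2
      · rw [hxy _ (by omega) h1, hxy r hr.1 h2, ih r hr.2 hr.1, if_pos h2, ← mul_neg,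
          show (l - r) / 2 = l / 2 - r / 2 by omega]
        congr 1
        abel
      · omega
      · omega
      · exact neg_zero
    · rw [neg_eq_zero]
      refine Finset.sum_eq_zero fun r hr => ?_
      rw [Finset.mem_Ico] at hr
      split_ifs with h1
      · rw [hy r hr.1 (by omega), ih r hr.2 hr.1, if_neg (by omega), Matrix.transpose_zero,
          neg_zero, add_zero, mul_zero]
      · rfl

lemma ofCoordinates_zero {n : ℕ} (h : n % 4 = 0) {x y : ℕ → Matrix (Fin 2) (Fin 2) k}
    (hy : ∀ l, 1 ≤ l → l % 2 = 1 → y l = 0) (hxy : ∀ l, 1 ≤ l → l % 2 = 0 → y l = x (l / 2)) :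
    ofCoordinates n 0 y = ofBlocks n (blocksNZero x) := by
  refine ofBlocks_congr fun p q hp hp' hq hq' => ?_
  rw [padOne_even (by omega), corner_zero]
  simp only [blocksUni, blocksNZero, Nat.even_iff, Nat.odd_iff, ite_self]
  split_ifs
  all_goals first
    | rfl
    | omega
    | (rw [hxy _ (by omega) (by omega)]; done)
    | (rw [hy _ (by omega) (by omega)]; done)
    | rw [hxy _ (by omega) (by omega), starThree_double hy hxy (by omega), if_pos (by omega)]
    | rw [hy _ (by omega) (by omega), starThree_double hy hxy (by omega), if_neg (by omega),
        Matrix.transpose_zero, neg_zero, add_zero]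

/-- `N` is the set of solutions with trivial diagonal block. -/
lemma mem_setN_iff {n : ℕ} (hn : 4 ≤ n) (X : Matrix (Fin n) (Fin n) k) :
    X ∈ setN k n ↔ X ∈ solMonoid (jordan k n ^ 2) ∧ blk n X (1 + n % 2) (1 + n % 2) = 1 := by
  have suff : ∀ (lam : k) (x : ℕ → Matrix (Fin 2) (Fin 2) k), Coordinates n lam x →
      X = ofCoordinates n lam x →
      X ∈ solMonoid (jordan k n ^ 2) ∧ blk n X (1 + n % 2) (1 + n % 2) = 1 := by
    rintro lam x h rfl
    exact ⟨h.mem hn, h.blk_eq_one hn⟩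
  rcases (by omega : n % 4 = 0 ∨ n % 4 = 2 ∨ n % 4 = 1 ∨ n % 4 = 3) with h | h | h | h
  · rw [setN, if_pos h]
    constructor
    · rintro ⟨x, hx⟩
      have h1 : ∀ l, 1 ≤ l → l % 2 = 1 → (fun l => if l % 2 = 0 then x (l / 2) else 0) l = 0 :=
        fun l _ hl' => if_neg (by omega)
      refine suff 0 (fun l => if l % 2 = 0 then x (l / 2) else 0)
        ⟨fun _ => rfl, fun _ => rfl, fun l hl hl' => ?_, fun h2 => by omega⟩ ?_
      · rw [if_neg (by omega), mul_zero, corner_zero, Matrix.transpose_zero, neg_zero, ite_self]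
      · rw [hx, ofCoordinates_zero h h1 fun l _ hl' => if_pos hl']
    · rintro ⟨hX, h1⟩
      have hc := coordinates_of_mem hn hX h1
      refine ⟨fun l => coordX n X (2 * l), ?_⟩
      rw [← ofCoordinates_zero h (y := coordX n X), ← hc.lam_even (by omega)]
      · exact eq_ofCoordinates hn hX h1
      · intro l hl hl'
        have := hc.first l hl (by omega)
        rwa [padOne_even (by omega), one_mul, hc.lam_even (by omega), corner_zero,
          Matrix.transpose_zero, neg_zero, ite_self] at this
      · intro l _ hl'
        rw [show 2 * (l / 2) = l by omega]
  · rw [setN, if_neg (by omega), if_pos h]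
    constructor
    · rintro ⟨x, hx⟩
      have h1 : ∀ l, 1 ≤ l → l % 2 = 0 →
          (fun l => if l % 2 = 1 then x ((l + 1) / 2) else 0) l = 0 :=
        fun l _ hl' => if_neg (by omega)
      refine suff 0 (fun l => if l % 2 = 1 then x ((l + 1) / 2) else 0)
        ⟨fun _ => rfl, fun _ => rfl, fun l hl hl' => ?_, fun h2 => by omega⟩ ?_
      · rw [if_neg (by omega), mul_zero, corner_zero, Matrix.transpose_zero, neg_zero, ite_self]
      · rw [hx, ofCoordinates_two h h1 fun l _ hl' => if_pos hl']
    · rintro ⟨hX, h1⟩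
      have hc := coordinates_of_mem hn hX h1
      refine ⟨fun l => coordX n X (2 * l - 1), ?_⟩
      rw [← ofCoordinates_two h (y := coordX n X), ← hc.lam_even (by omega)]
      · exact eq_ofCoordinates hn hX h1
      · intro l hl hl'
        have := hc.first l hl (by omega)
        rwa [padOne_even (by omega), one_mul, hc.lam_even (by omega), corner_zero,
          Matrix.transpose_zero, neg_zero, ite_self] at this
      · intro l _ hl'
        rw [show 2 * ((l + 1) / 2) - 1 = l by omega]
  · rw [setN, if_neg (by omega), if_neg (by omega), if_pos h]
    constructor
    · rintro ⟨x, ⟨hodd, heven⟩, hx⟩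
      refine suff 0 x ⟨fun _ => rfl, fun _ => rfl, fun l hl hl' => ?_, fun _ l hl hl' => ?_⟩ ?_
      · rw [padOne_odd (by omega), if_neg (by omega)]
        exact exists_top_row_zero.1 (heven l (Nat.even_iff.2 (by omega)))
      · exact exists_bottom_row.1 (hodd l (Nat.odd_iff.2 (by omega)))
      · rw [hx, ofCoordinates_one h]
    · rintro ⟨hX, h1⟩
      have hc := coordinates_of_mem hn hX h1
      refine ⟨coordX n X, ⟨fun l hl => ?_, fun l hl => ?_⟩, ?_⟩
      · rw [Nat.odd_iff] at hl
        exact exists_bottom_row.2 (hc.pad (by omega) l (by omega) (by omega))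
      · rw [Nat.even_iff] at hl
        rw [exists_top_row_zero]
        rcases Nat.eq_zero_or_pos l with rfl | hl0
        · simp [coordX]
        · have := hc.first l hl0 (by omega)
          rwa [padOne_odd (by omega), if_neg (by omega)] at this
      · rw [← ofCoordinates_one h, ← hc.lam_odd (by omega)]
        exact eq_ofCoordinates hn hX h1
  · rw [setN, if_neg (by omega), if_neg (by omega), if_neg (by omega)]
    constructor
    · rintro ⟨lam, x, ⟨hone, hodd, heven⟩, hx⟩
      refine suff lam x ⟨fun _ => by omega, fun _ => by omega, fun l hl hl' => ?_,
        fun _ l hl hl' => ?_⟩ ?_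
      · rw [padOne_odd (by omega)]
        split_ifs with hl1
        · subst hl1
          exact exists_top_row.1 hone
        · exact exists_top_row_zero.1 (hodd l (by omega) (Nat.odd_iff.2 (by omega)))
      · exact exists_bottom_row.1 (heven l (Nat.even_iff.2 (by omega)))
      · rw [hx, ofCoordinates_three h]
    · rintro ⟨hX, h1⟩
      have hc := coordinates_of_mem hn hX h1
      refine ⟨blk n X 2 1 0 1, coordX n X, ⟨?_, fun l hl hl' => ?_, fun l hl => ?_⟩, ?_⟩
      · have := hc.first 1 le_rfl (by omega)
        rw [padOne_odd (by omega), if_pos rfl] at this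
        exact exists_top_row.2 this
      · rw [Nat.odd_iff] at hl'
        have := hc.first l (by omega) (by omega)
        rw [padOne_odd (by omega), if_neg (by omega)] at this
        exact exists_top_row_zero.2 this
      · rw [Nat.even_iff] at hl
        rw [exists_bottom_row]
        rcases Nat.eq_zero_or_pos l with rfl | hl0
        · simp [coordX]
        · exact hc.pad (by omega) l hl0 (by omega)
      · rw [← ofCoordinates_three h]
        exact eq_ofCoordinates hn hX h1

/-! ### Block diagonal solutions -/

/-- Elements of `D` are block diagonal solutions. -/
lemma setD_subset {n : ℕ} {X : Matrix (Fin n) (Fin n) k} (hX : X ∈ setD k n) :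
    X ∈ solMonoid (jordan k n ^ 2) ∧ ∀ p q, 1 ≤ p → p ≤ (n + 1) / 2 → 1 ≤ q → q ≤ (n + 1) / 2 →
      p ≠ q → blk n X p q = 0 := by
  obtain ⟨f, hf, hpad, rfl⟩ : ∃ f : ℕ → Matrix (Fin 2) (Fin 2) k,
      (∀ i, 1 ≤ i → i < (n + 1) / 2 →
        (f i)ᵀ * f (i + 1) = if i = 1 then padOne k n else 1) ∧
      Padded n (fun p q => if p = q then f p else 0) ∧
      X = ofBlocks n (fun p q => if p = q then f p else 0) := by
    rcases Nat.mod_two_eq_zero_or_one n with h | h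
    · rw [setD, if_pos (Nat.even_iff.2 h)] at hX
      obtain ⟨g, rfl⟩ := hX
      refine ⟨fun p => if Odd p then (g : Matrix (Fin 2) (Fin 2) k) else
        ((g⁻¹ : GL (Fin 2) k) : Matrix (Fin 2) (Fin 2) k)ᵀ, fun i _ _ => ?_,
        fun h' => by omega, rfl⟩
      rw [padOne_even h, ite_self]
      have e1 : (g : Matrix (Fin 2) (Fin 2) k)ᵀ * ((g⁻¹ : GL (Fin 2) k) :
          Matrix (Fin 2) (Fin 2) k)ᵀ = 1 := by
        rw [← Matrix.transpose_mul, Units.inv_mul, Matrix.transpose_one]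
      rcases Nat.even_or_odd i with hi | hi
      · simp only [if_neg (Nat.not_odd_iff_even.2 hi), if_pos hi.add_one,
          Matrix.transpose_transpose, Units.inv_mul]
      · simp only [if_pos hi, if_neg (Nat.not_odd_iff_even.2 hi.add_one), e1]
    · rw [setD, if_neg (by rw [Nat.even_iff]; omega)] at hX
      obtain ⟨α, β, c, rfl⟩ := hX
      have hdet : IsUnit (!![(α : k), c; 0, (β : k)⁻¹] : Matrix (Fin 2) (Fin 2) k).det := by
        rw [Matrix.det_fin_two_of, mul_zero, sub_zero]
        exact (mul_ne_zero α.ne_zero (inv_ne_zero β.ne_zero)).isUnit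
      refine ⟨fun p => if p = 1 then !![0, 0; 0, (β : k)]
        else if Even p then !![(α : k), c; 0, (β : k)⁻¹]
        else ((!![(α : k), c; 0, (β : k)⁻¹] : Matrix (Fin 2) (Fin 2) k)⁻¹)ᵀ,
        fun i hi _ => ?_, fun _ p hp b => ?_, rfl⟩
      · by_cases hi1 : i = 1
        · subst hi1
          simp only [if_true, show ¬ (1 + 1 = 1) by omega, if_false, show Even (1 + 1) by decide,
            padOne_odd h]
          ext i j
          fin_cases i <;> fin_cases j <;> simp [Matrix.mul_apply, Fin.sum_univ_two]
        · simp only [if_neg hi1, if_neg (show i + 1 ≠ 1 by omega)]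
          rcases Nat.even_or_odd i with hi | hi
          · simp only [if_pos hi, if_neg (Nat.not_even_iff_odd.2 hi.add_one)]
            rw [← Matrix.transpose_mul, Matrix.nonsing_inv_mul _ hdet, Matrix.transpose_one]
          · simp only [if_neg (Nat.not_even_iff_odd.2 hi), if_pos hi.add_one,
              Matrix.transpose_transpose]
            rw [Matrix.nonsing_inv_mul _ hdet]
      · by_cases hp1 : p = 1
        · subst hp1
          fin_cases b <;> simp
        · simp [hp1, Ne.symm hp1]
  have hblk : ∀ p q, 1 ≤ p → p ≤ (n + 1) / 2 → 1 ≤ q → q ≤ (n + 1) / 2 →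
      blk n (ofBlocks n (fun p q => if p = q then f p else 0)) p q =
        if p = q then f p else 0 := fun p q hp hp' hq hq' => blk_ofBlocks hpad hp hp' hq hq'
  refine ⟨?_, fun p q hp hp' hq hq' hpq => by rw [hblk p q hp hp' hq hq', if_neg hpq]⟩
  rw [mem_solMonoid_iff_blk]
  intro i j hi hi' hj hj'
  have e0 : ∀ p ∈ Finset.Ico 1 ((n + 1) / 2),
      (blk n (ofBlocks n (fun p q => if p = q then f p else 0)) p i)ᵀ *
        blk n (ofBlocks n (fun p q => if p = q then f p else 0)) (p + 1) j =
      if p = i then (if j = i + 1 then (f i)ᵀ * f (i + 1) else 0) else 0 := by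
    intro p hp
    rw [Finset.mem_Ico] at hp
    rw [hblk p i hp.1 (by omega) hi hi', hblk (p + 1) j (by omega) (by omega) hj hj']
    by_cases h1 : p = i
    · subst h1
      rw [if_pos rfl, if_pos rfl]
      by_cases h2 : j = p + 1
      · rw [if_pos h2, if_pos h2.symm]
      · rw [if_neg h2, if_neg (Ne.symm h2), mul_zero]
    · rw [if_neg h1, if_neg h1, Matrix.transpose_zero, zero_mul]
  rw [Finset.sum_congr rfl e0, Finset.sum_ite_eq']
  by_cases h1 : j = i + 1
  · rw [if_pos h1, if_pos h1, if_pos (Finset.mem_Ico.2 ⟨hi, by omega⟩), hf i hi (by omega)]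
  · rw [if_neg h1, if_neg h1, ite_self]

/-- Every invertible diagonal block of a solution comes from `D`. -/
lemma exists_mem_setD {n : ℕ} (hn : 4 ≤ n) {X : Matrix (Fin n) (Fin n) k}
    (hX : X ∈ solMonoid (jordan k n ^ 2)) (hu : IsUnit (blk n X (1 + n % 2) (1 + n % 2))) :
    ∃ Y ∈ setD k n, blk n Y (1 + n % 2) (1 + n % 2) = blk n X (1 + n % 2) (1 + n % 2) := by
  rcases Nat.mod_two_eq_zero_or_one n with h | h
  · obtain ⟨g, hg⟩ := hu
    refine ⟨ofBlocks n (blocksDEven g), ?_, ?_⟩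
    · rw [setD, if_pos (Nat.even_iff.2 h)]
      exact ⟨g, rfl⟩
    · rw [blk_ofBlocks (fun h' => by omega) (by omega) (by omega) (by omega) (by omega), ← hg, h]
      simp [blocksDEven]
  · rw [h] at hu ⊢
    have h10 : blk n X (1 + 1) (1 + 1) 1 0 = 0 :=
      pent_first_cols hn hX (by simp; omega) (by simp; omega)
    have hdet := (Matrix.isUnit_iff_isUnit_det _).1 hu
    rw [Matrix.det_fin_two, h10, mul_zero, sub_zero] at hdet
    have h00 := (isUnit_of_mul_isUnit_left hdet).ne_zero
    have h11 := (isUnit_of_mul_isUnit_right hdet).ne_zero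
    refine ⟨ofBlocks n (blocksDOdd (Units.mk0 _ h00) (Units.mk0 _ (inv_ne_zero h11))
      (blk n X (1 + 1) (1 + 1) 0 1)), ?_, ?_⟩
    · rw [setD, if_neg (by rw [Nat.even_iff]; omega)]
      exact ⟨_, _, _, rfl⟩
    · rw [blk_ofBlocks ?_ (by omega) (by omega) (by omega) (by omega)]
      · rw [blocksDOdd, if_pos rfl, if_neg (by omega), if_pos (by decide)]
        ext i j
        fin_cases i <;> fin_cases j <;> simp [h10]
      · intro _ p hp b
        by_cases hp1 : p = 1
        · subst hp1
          fin_cases b <;> simp [blocksDOdd]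
        · simp [blocksDOdd, hp1, Ne.symm hp1]

lemma eq_one_of_blk_diag {n : ℕ} (hn : 4 ≤ n) {X : Matrix (Fin n) (Fin n) k}
    (hX : X ∈ solMonoid (jordan k n ^ 2))
    (hD : ∀ p q, 1 ≤ p → p ≤ (n + 1) / 2 → 1 ≤ q → q ≤ (n + 1) / 2 → p ≠ q → blk n X p q = 0)
    (h1 : blk n X (1 + n % 2) (1 + n % 2) = 1) : X = 1 := by
  refine eq_of_blk_eq fun p q hp hp' hq hq' => ?_
  rw [blk_one hp hp']
  split_ifs with h2 h3
  · subst h2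
    rw [blk_diag_eq hn hX h1 hp hp', if_pos h3]
  · subst h2
    rw [blk_diag_eq hn hX h1 hp hp', if_neg h3]
  · exact hD p q hp hp' hq hq' h2

lemma blk_one_diag {n : ℕ} (hn : 4 ≤ n) :
    blk n (1 : Matrix (Fin n) (Fin n) k) (1 + n % 2) (1 + n % 2) = 1 := by
  rw [blk_one (by omega) (by omega), if_pos rfl]
  split_ifs
  · exact padOne_even (by omega)
  · rfl

/-! ### The group structure -/

/-- The diagonal block, as a homomorphism. -/
def diagHom (k : Type*) [Field k] {n : ℕ} (hn : 4 ≤ n) :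
    solGroup (jordan k n ^ 2) →* Matrix (Fin 2) (Fin 2) k where
  toFun X := blk n ((X : GL (Fin n) k) : Matrix (Fin n) (Fin n) k) (1 + n % 2) (1 + n % 2)
  map_one' := blk_one_diag hn
  map_mul' X Y := blk_mul_diag hn X.2 Y.2 (by omega) (by omega)

/-- A solution as an element of the group. -/
noncomputable def toSolGroup {n : ℕ} (hn : 4 ≤ n) (X : Matrix (Fin n) (Fin n) k)
    (hX : X ∈ solMonoid (jordan k n ^ 2)) : solGroup (jordan k n ^ 2) :=
  ⟨(isUnit_of_mem_solMonoid hn hX).unit, hX⟩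

lemma solGroup_ext {n : ℕ} {X Y : solGroup (jordan k n ^ 2)}
    (h : ((X : GL (Fin n) k) : Matrix (Fin n) (Fin n) k) = (Y : GL (Fin n) k)) : X = Y :=
  Subtype.ext (Units.ext h)

lemma exists_block_diag {n : ℕ} (hn : 4 ≤ n) (X : solGroup (jordan k n ^ 2)) :
    ∃ Y : solGroup (jordan k n ^ 2),
      ((Y : GL (Fin n) k) : Matrix (Fin n) (Fin n) k) ∈ setD k n ∧
      diagHom k hn Y = diagHom k hn X := by
  obtain ⟨Y, hY, h⟩ := exists_mem_setD hn X.2 ((Group.isUnit X).map (diagHom k hn))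
  exact ⟨toSolGroup hn Y (setD_subset hY).1, hY, h⟩

/-- The submonoid of block diagonal solutions. -/
def blockDiagSubmonoid (k : Type*) [Field k] (n : ℕ) :
    Submonoid (solGroup (jordan k n ^ 2)) where
  carrier := {X | ∀ p q, 1 ≤ p → p ≤ (n + 1) / 2 → 1 ≤ q → q ≤ (n + 1) / 2 → p ≠ q →
    blk n ((X : GL (Fin n) k) : Matrix (Fin n) (Fin n) k) p q = 0}
  one_mem' p q hp hp' _ _ hpq := (blk_one hp hp').trans (if_neg hpq)
  mul_mem' {X Y} hX hY p q hp hp' hq hq' hpq := by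
    refine (blk_mul n _ _ p q).trans (Finset.sum_eq_zero fun r hr => ?_)
    rw [Finset.mem_Icc] at hr
    by_cases hpr : p = r
    · subst hpr
      rw [hY p q hp hp' hq hq' hpq, mul_zero]
    · rw [hX p r hp hp' hr.1 hr.2 hpr, zero_mul]

lemma eq_one_of_mem_blockDiag {n : ℕ} (hn : 4 ≤ n) {X : solGroup (jordan k n ^ 2)}
    (hX : X ∈ blockDiagSubmonoid k n) (h : diagHom k hn X = 1) : X = 1 :=
  solGroup_ext (eq_one_of_blk_diag hn X.2 hX h)

/-- The subgroup `D`. -/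
def blockDiagSubgroup (k : Type*) [Field k] {n : ℕ} (hn : 4 ≤ n) :
    Subgroup (solGroup (jordan k n ^ 2)) where
  toSubmonoid := blockDiagSubmonoid k n
  inv_mem' {X} hX := by
    obtain ⟨Y, hY, h⟩ := exists_block_diag hn X⁻¹
    have hY' : Y ∈ blockDiagSubmonoid k n := (setD_subset hY).2
    have h1 : X * Y = 1 := eq_one_of_mem_blockDiag hn (mul_mem hX hY') (by
      rw [map_mul, h, ← map_mul, mul_inv_cancel, map_one])
    change X⁻¹ ∈ blockDiagSubmonoid k n
    rwa [inv_eq_of_mul_eq_one_right h1]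

lemma mem_blockDiagSubgroup_iff {n : ℕ} (hn : 4 ≤ n) (X : solGroup (jordan k n ^ 2)) :
    X ∈ blockDiagSubgroup k hn ↔
      ((X : GL (Fin n) k) : Matrix (Fin n) (Fin n) k) ∈ setD k n := by
  constructor
  · intro hX
    obtain ⟨Y, hY, h⟩ := exists_block_diag hn X
    have hY' : Y ∈ blockDiagSubgroup k hn := (setD_subset hY).2
    have h1 : Y⁻¹ * X = 1 := eq_one_of_mem_blockDiag hn
      ((blockDiagSubgroup k hn).mul_mem ((blockDiagSubgroup k hn).inv_mem hY') hX) (by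
        rw [map_mul, ← h, ← map_mul, inv_mul_cancel, map_one])
    rwa [← inv_mul_eq_one.1 h1]
  · exact fun hX => (setD_subset hX).2

lemma isComplement'_ker_diagHom {n : ℕ} (hn : 4 ≤ n) :
    (diagHom k hn).ker.IsComplement' (blockDiagSubgroup k hn) := by
  refine Subgroup.isComplement'_of_disjoint_and_mul_eq_univ ?_ ?_
  · rw [Subgroup.disjoint_def]
    exact fun hX hD => eq_one_of_mem_blockDiag hn hD hX
  · refine Set.eq_univ_of_forall fun X => ?_
    obtain ⟨Y, hY, h⟩ := exists_block_diag hn X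
    refine ⟨X * Y⁻¹, ?_, Y, (setD_subset hY).2, inv_mul_cancel_right X Y⟩
    change diagHom k hn (X * Y⁻¹) = 1
    rw [map_mul, ← h, ← map_mul, mul_inv_cancel, map_one]

/-- An internal semidirect product is isomorphic to the external one. -/
lemma exists_mulEquiv_of_isComplement' {G : Type*} [Group G] {N D : Subgroup G} [N.Normal]
    (h : N.IsComplement' D) :
    ∃ e : N ⋊[(MulAut.conjNormal (H := N)).comp D.subtype] D ≃* G,
      ∀ (u : N) (d : D), e ⟨u, d⟩ = (u : G) * (d : G) := by
  let f : N ⋊[(MulAut.conjNormal (H := N)).comp D.subtype] D →* G :=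
    SemidirectProduct.lift N.subtype D.subtype fun d => by
      ext u
      simp [MulAut.conjNormal_apply]
  have hf : Function.Bijective f :=
    (SemidirectProduct.equivProd.bijective_comp (fun x : N × D => (x.1 : G) * (x.2 : G))).2 h
  exact ⟨MulEquiv.ofBijective f hf, fun _ _ => rfl⟩

end CongruenceSol

theorem mainTheorem4 {k : Type*} [Field k] (n : ℕ) (hn : 4 ≤ n) :
    (∀ X ∈ CongruenceSol.solMonoid (CongruenceSol.jordan k n ^ 2), IsUnit X) ∧
    ∃ (D N : Subgroup (CongruenceSol.solGroup (CongruenceSol.jordan k n ^ 2))) (_ : N.Normal),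
      (fun X : CongruenceSol.solGroup (CongruenceSol.jordan k n ^ 2) =>
        ((X : GL (Fin n) k) : Matrix (Fin n) (Fin n) k)) '' (D : Set _) = CongruenceSol.setD k n ∧
      (fun X : CongruenceSol.solGroup (CongruenceSol.jordan k n ^ 2) =>
        ((X : GL (Fin n) k) : Matrix (Fin n) (Fin n) k)) '' (N : Set _) = CongruenceSol.setN k n ∧
      N.IsComplement' D ∧
      ∃ e : N ⋊[(MulAut.conjNormal (H := N)).comp D.subtype] D ≃*
          CongruenceSol.solGroup (CongruenceSol.jordan k n ^ 2),
        ∀ (u : N) (d : D), e ⟨u, d⟩ =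
          (u : CongruenceSol.solGroup (CongruenceSol.jordan k n ^ 2)) *
            (d : CongruenceSol.solGroup (CongruenceSol.jordan k n ^ 2)) := by
  refine ⟨fun X hX => CongruenceSol.isUnit_of_mem_solMonoid hn hX,
    CongruenceSol.blockDiagSubgroup k hn, (CongruenceSol.diagHom k hn).ker, inferInstance,
    ?_, ?_, CongruenceSol.isComplement'_ker_diagHom hn,
    CongruenceSol.exists_mulEquiv_of_isComplement' (CongruenceSol.isComplement'_ker_diagHom hn)⟩
  · ext X
    constructor
    · rintro ⟨Y, hY, rfl⟩
      exact (CongruenceSol.mem_blockDiagSubgroup_iff hn Y).1 hY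
    · intro hX
      exact ⟨CongruenceSol.toSolGroup hn X (CongruenceSol.setD_subset hX).1,
        (CongruenceSol.mem_blockDiagSubgroup_iff hn _).2 hX, rfl⟩
  · ext X
    rw [CongruenceSol.mem_setN_iff hn]
    constructor
    · rintro ⟨Y, hY, rfl⟩
      exact ⟨Y.2, hY⟩
    · rintro ⟨hX, h⟩
      exact ⟨CongruenceSol.toSolGroup hn X hX, h, rfl⟩
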